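/- Let $T>0$ and let $X$ be an $\mathbb R^n$-valued Lévy process without Gaussian part and with Lévy measure $\nu$. Put $G(\lambda)=\log\mathbb E[e^{\langle\lambda,X_1\rangle}]\in(-\infty,\infty]$. Assume (A1) $\int_{|x|>1}e^{\lambda_0|x|}\,\nu(dx)<\infty$ for some $\lambda_0>0$; (A2) $G$ is lower semicontinuous and its effective domain $\{G<\infty\}$ is bounded. Let $M$ be the set of bounded $\mathbb R^n$-valued measures on $[0,T]$, let $V_r$ be the set of right-continuous functions $x:[0,T]\to\mathbb R^n$ with left limits and of bounded variation, and let $V_r^{ac}\subset V_r$ be the set of absolutely continuous $x$ with $x_0=0$, normed by $\int_0^T|\dot x_s|\,ds$. We say that $x^k\to x$ in $\sigma(D,M)$ if $\int_{[0,T]}x^k_t\cdot\mu(dt)\to\int_{[0,T]}x_t\cdot\mu(dt)$ for all $\mu\in M$. Put $$\mathcal G(\theta)=\int_{[0,T]}G(\theta([t,T]))\,dt,\qquad \bar J(x)=\sup_{\mu\in M}\Big\{\int_{[0,T]}x_t\cdot\mu(dt)-\mathcal G(\mu)\Big\}\quad(\theta\in M,\ x\in V_r).$$ For a functional $H$ of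 the path put $$F(\theta)=\sup_{x\in V_r}\Big\{2H(x)-\int_{[0,T]}x_t\cdot\theta(dt)+\mathcal G(\theta)-\bar J(x)\Big\},\qquad \widehat H(\theta)=\sup_{x\in V_r}\Big\{H(x)-\int_{[0,T]}x_t\cdot\theta(dt)\Big\},$$ where in $F$ the terms with $H(x)=-\infty$ or $\bar J(x)=\infty$ count as $-\infty$. Call $\theta^*\in M$ asymptotically optimal if it minimizes $F$ over $M$. Let $h:\mathbb R^n\to[-\infty,\infty)$ be concave, upper semicontinuous and not identically $-\infty$, and let $H(x)=h(x_T)$. Put $\hat h(\theta)=\sup_{v\in\mathbb R^n}\{h(v)-\langle v,\theta\rangle\}$ and $f(\theta)=\hat h(\theta)+T\,G(\theta)$ for $\theta\in\mathbb R^n$. Then: 1. The hypotheses of the duality theorem hold: $H$ is concave and upper semicontinuous on $V_r^{ac}$; every $x\in V_r$ is the $\sigma(D,M)$-limit of a sequence $(x^k)$ with $x^k-x_0\in V_r^{ac}$ and $H(x^k)\to H(x)$ (so $x^k\in V_r^{ac}$ if $x_0=0$); and (A2) holds. 2. $\inf_{\theta\in M}F(\theta)=2\inf_{\theta\in M}\{\widehat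 H(\theta)+\mathcal G(\theta)\}=2\inf_{\theta\in\mathbb R^n}f(\theta)$, and $f$ is convex. 3. $f$ attains its minimum over $\mathbb R^n$. For every minimizer $\bar\theta^*$ of $f$, the measure $\bar\theta^*\delta_T$ is asymptotically optimal and minimizes $\widehat H+\mathcal G$ over $M$. 4. If $f$ is not identically $+\infty$, then its minimizer $\bar\theta^*$ is unique, $\theta\in M$ minimizes $\widehat H+\mathcal G$ if and only if $\theta=\bar\theta^*\delta_T$, and $\theta\in M$ is asymptotically optimal if and only if its restriction to $(0,T]$ equals $\bar\theta^*\delta_T$ (so $\bar\theta^*\delta_T$ is the only asymptotically optimal parameter without an atom at time $0$). -/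

import Mathlib

open MeasureTheory ProbabilityTheory Filter Topology
open scoped NNReal ENNReal

noncomputable section

namespace LevyIS

/-- `ℝⁿ` with its Euclidean norm and inner product. -/
abbrev E (n : ℕ) := EuclideanSpace ℝ (Fin n)

/-- Paths `[0,T] → ℝⁿ`. -/
abbrev LPath (n : ℕ) (T : ℝ) := Set.Icc (0 : ℝ) T → E n

/-- The class `M` of bounded `ℝⁿ`-valued measures on `[0,T]`. (A countably additive set function
with values in `ℝⁿ` automatically has finite total variation.) -/
abbrev M (n : ℕ) (T : ℝ) := VectorMeasure (Set.Icc (0 : ℝ) T) (E n)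

/-- The time `0` as a point of `[0,T]`. -/
def initTime {T : ℝ} (hT : 0 < T) : Set.Icc (0 : ℝ) T := ⟨0, le_refl 0, hT.le⟩

/-- The time `T` as a point of `[0,T]`. -/
def finalTime {T : ℝ} (hT : 0 < T) : Set.Icc (0 : ℝ) T := ⟨T, hT.le, le_refl T⟩

/-! ### Lévy processes -/

/-- Right-continuous functions with left limits. -/
def IsRCLL {ι F : Type*} [Preorder ι] [TopologicalSpace ι] [TopologicalSpace F]
    (f : ι → F) : Prop :=
  ∀ t, ContinuousWithinAt f (Set.Ici t) t ∧ ∃ l, Tendsto f (𝓝[<] t) (𝓝 l)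

/-- `X` is an `ℝⁿ`-valued Lévy process under `P`. -/
structure IsLevyProcess {n : ℕ} {Ω : Type*} [MeasurableSpace Ω] (X : ℝ≥0 → Ω → E n)
    (P : Measure Ω) : Prop where
  measurable : ∀ t, Measurable (X t)
  start : ∀ᵐ ω ∂P, X 0 ω = 0
  indep : HasIndepIncrements X P
  stationary : ∀ s t, IdentDistrib (fun ω => X (s + t) ω - X s ω) (X t) P P
  rcll : ∀ᵐ ω ∂P, IsRCLL (fun t => X t ω)

/-- `ν` is a Lévy measure on `ℝⁿ`. -/
def IsLevyMeasure {n : ℕ} (ν : Measure (E n)) : Prop :=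
  ν {0} = 0 ∧ ∫⁻ x, ENNReal.ofReal (min (‖x‖ ^ 2) 1) ∂ν < ∞

/-- `X` has Lévy triplet `(0, ν, γ)` (no diffusion part): the Lévy–Khintchine formula. -/
def HasLevyTriplet {n : ℕ} {Ω : Type*} [MeasurableSpace Ω] (X : ℝ≥0 → Ω → E n)
    (P : Measure Ω) (ν : Measure (E n)) (γ : E n) : Prop :=
  IsLevyMeasure ν ∧ ∀ (t : ℝ≥0) (u : E n),
    ∫ ω, Complex.exp (Complex.I * (inner ℝ u (X t ω) : ℝ)) ∂P =
      Complex.exp ((t : ℝ) * (Complex.I * (inner ℝ u γ : ℝ) +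
        ∫ x, (Complex.exp (Complex.I * (inner ℝ u x : ℝ)) - 1 -
          Complex.I * (Set.indicator (Metric.closedBall 0 1) (fun y => inner ℝ u y) x : ℝ)) ∂ν))

/-- Assumption (A1): some exponential moment of the large jumps is finite. -/
def AssumptionA1 {n : ℕ} (ν : Measure (E n)) : Prop :=
  ∃ lam : ℝ, 0 < lam ∧ ∫⁻ x in {x : E n | 1 < ‖x‖}, ENNReal.ofReal (Real.exp (lam * ‖x‖)) ∂ν < ∞

/-- `G(λ) = log E[exp ⟨λ, X₁⟩]`, with values in `(-∞, ∞]`. -/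
def cumulant {n : ℕ} {Ω : Type*} [MeasurableSpace Ω] (X : ℝ≥0 → Ω → E n) (P : Measure Ω) :
    E n → EReal :=
  fun lam => ENNReal.log (∫⁻ ω, ENNReal.ofReal (Real.exp (inner ℝ lam (X 1 ω))) ∂P)

/-- Assumption (A2): `G` is lower semicontinuous and its effective domain is bounded. -/
def AssumptionA2 {n : ℕ} (G : E n → EReal) : Prop :=
  LowerSemicontinuous G ∧ Bornology.IsBounded {lam | G lam < ⊤}

/-! ### Path spaces and the functionals -/

/-- `V_r`: right-continuous paths with left limits and of bounded variation on `[0,T]`. -/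
def Vr (n : ℕ) (T : ℝ) : Set (LPath n T) :=
  {x | IsRCLL x ∧ BoundedVariationOn x Set.univ}

/-- `x` is absolutely continuous with `x₀ = 0` and derivative `g ∈ L¹`. -/
def HasVelocity {n : ℕ} {T : ℝ} (x : LPath n T) (g : ℝ → E n) : Prop :=
  IntegrableOn g (Set.Icc 0 T) ∧ ∀ t, x t = ∫ s in (0 : ℝ)..t, g s

/-- `V_r^{ac}`: absolutely continuous paths with `x₀ = 0`; the norm of `x` is `∫₀ᵀ ‖ẋ_s‖ ds`. -/
def Vac (n : ℕ) (T : ℝ) : Set (LPath n T) := {x | ∃ g, HasVelocity x g}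

/-- `∫_{[0,T]} x_t · θ(dt)`. -/
def pairing {n : ℕ} {T : ℝ} (x : LPath n T) (θ : M n T) : ℝ :=
  θ.integral x (innerSL ℝ : E n →L[ℝ] E n →L[ℝ] ℝ)

/-- Convergence of a sequence of paths in the topology `σ(D,M)`. -/
def SigmaTendsto {n : ℕ} {T : ℝ} (y : ℕ → LPath n T) (x : LPath n T) : Prop :=
  ∀ θ : M n T, Tendsto (fun k => pairing (y k) θ) atTop (𝓝 (pairing x θ))

/-- The integral over `[0,T]` of an extended real function (positive part minus negative part). -/
def eintegral {T : ℝ} (f : Set.Icc (0 : ℝ) T → EReal) : EReal :=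
  ((∫⁻ t, (f t).toENNReal ∂(volume.comap Subtype.val) : ℝ≥0∞) : EReal) -
    ((∫⁻ t, (-f t).toENNReal ∂(volume.comap Subtype.val) : ℝ≥0∞) : EReal)

/-- `∫_{[0,T]} G(θ([t,T])) dt`. -/
def cumulantIntegral {n : ℕ} {T : ℝ} (G : E n → EReal) (θ : M n T) : EReal :=
  eintegral fun t => G (θ (Set.Ici t))

open Classical in
/-- The rate function `J̄`. -/
def rate {n : ℕ} {T : ℝ} (G : E n → EReal) (x : LPath n T) : EReal :=
  if x ∈ Vr n T then ⨆ μ : M n T, ((pairing x μ : ℝ) : EReal) - cumulantIntegral G μ else ⊤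

/-- The proxy of the variance:
`sup_{x ∈ V_r} {2 H(x) - ∫ x_t · θ(dt) + ∫ G(θ([t,T])) dt - J̄(x)}`. As `EReal` addition is
absorbed by `⊥`, terms with `J̄(x) = ∞` or `H(x) = -∞` count as `-∞`. -/
def varianceProxy {n : ℕ} {T : ℝ} (G : E n → EReal) (H : LPath n T → EReal) (θ : M n T) : EReal :=
  ⨆ x ∈ Vr n T, (2 * H x - ((pairing x θ : ℝ) : EReal) + cumulantIntegral G θ - rate G x)

/-- `θ` is asymptotically optimal if it minimizes the proxy of the variance over `M`. -/
def AsymptoticallyOptimal {n : ℕ} {T : ℝ} (G : E n → EReal) (H : LPath n T → EReal)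
    (θ : M n T) : Prop :=
  IsMinOn (varianceProxy G H) Set.univ θ

/-- `Ĥ(θ) = sup_{x ∈ V_r} {H(x) - ∫ x_t · θ(dt)}`. -/
def pathConjugate {n : ℕ} {T : ℝ} (H : LPath n T → EReal) (θ : M n T) : EReal :=
  ⨆ x ∈ Vr n T, (H x - ((pairing x θ : ℝ) : EReal))

/-- The dual functional `Ĥ(θ) + ∫ G(θ([t,T])) dt`. -/
def dualFunctional {n : ℕ} {T : ℝ} (G : E n → EReal) (H : LPath n T → EReal) (θ : M n T) : EReal :=
  pathConjugate H θ + cumulantIntegral G θ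

/-- `f` is concave along segments of `s`, for functions with values in `[-∞, ∞)`. -/
def EConcaveOn {V : Type*} [AddCommGroup V] [Module ℝ V] (s : Set V) (f : V → EReal) : Prop :=
  ∀ x ∈ s, ∀ y ∈ s, ∀ a b : ℝ, 0 < a → 0 < b → a + b = 1 →
    (a : EReal) * f x + (b : EReal) * f y ≤ f (a • x + b • y)

/-- `f` is convex along segments of `s`, for functions with values in `(-∞, ∞]`. -/
def EConvexOn {V : Type*} [AddCommGroup V] [Module ℝ V] (s : Set V) (f : V → EReal) : Prop :=
  ∀ x ∈ s, ∀ y ∈ s, ∀ a b : ℝ, 0 < a → 0 < b → a + b = 1 →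
    f (a • x + b • y) ≤ (a : EReal) * f x + (b : EReal) * f y

/-- The hypotheses of the duality theorem. -/
structure DualityHypotheses {n : ℕ} {T : ℝ} (hT : 0 < T) (G : E n → EReal)
    (H : LPath n T → EReal) : Prop where
  /-- `H` is concave on `V_r^{ac}`. -/
  concave : EConcaveOn (Vac n T) H
  /-- `H` is upper semicontinuous on `V_r^{ac}` for the norm `∫₀ᵀ ‖ẋ_s‖ ds`. -/
  usc : ∀ x ∈ Vac n T, ∀ c : EReal, H x < c → ∃ δ : ℝ, 0 < δ ∧
    ∀ y ∈ Vac n T, ∀ g, HasVelocity (y - x) g → ∫ s in (0 : ℝ)..T, ‖g s‖ < δ → H y < c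
  /-- Every `x ∈ V_r` is the `σ(D,M)`-limit of absolutely continuous paths `y k` with the same
  starting point (so `y k ∈ V_r^{ac}` when `x₀ = 0`), along which `H` converges to `H x`. -/
  approx : ∀ x ∈ Vr n T, ∃ y : ℕ → LPath n T,
    (∀ k, (fun t => y k t - x (initTime hT)) ∈ Vac n T) ∧ SigmaTendsto y x ∧
      Tendsto (fun k => H (y k)) atTop (𝓝 (H x))
  /-- (A2). -/
  a2 : AssumptionA2 G

/-! ### European log-payoffs -/

/-- The European log-payoff `H(x) = h(x_T)`. -/
def europeanLogPayoff {n : ℕ} {T : ℝ} (hT : 0 < T) (h : E n → EReal) : LPath n T → EReal :=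
  fun x => h (x (finalTime hT))

/-- `ĥ(θ) = sup_v {h(v) - ⟨v, θ⟩}`. -/
def conjugate {n : ℕ} (h : E n → EReal) (θ : E n) : EReal :=
  ⨆ v : E n, (h v - ((inner ℝ v θ : ℝ) : EReal))

/-- The finite-dimensional objective `ĥ(θ) + T G(θ)`. -/
def euroObjective {n : ℕ} (T : ℝ) (G : E n → EReal) (h : E n → EReal) (θ : E n) : EReal :=
  conjugate h θ + (T : EReal) * G θ

end LevyIS

end

/-! The payoff h(x_T) leaves the path free before time T: adding u·1_[s,T) to x does not change H
and moves the pairing with θ linearly. Hence Ĥ(θ) = ∞ unless θ is carried by {T}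
(`pathConjugate_eq_top`), and at vδ_T the dual functional equals f(v). The function f is lower
semicontinuous and finite only where G is, so it attains its minimum on a ball. Uniqueness comes
from strict convexity of G (`cumulant_midpoint_lt`), which follows from boundedness of its effective
domain.

The proxy F is compared with 2f from both sides. Above: if θ agrees with vδ_T on (0,T], then 2vδ_T −
θ is a test measure in J̄(x) that cancels the pairing of x with θ, and F(θ) ≤ 2f(v) results
(`varianceProxy_le_of_tail`). Below: it suffices to test F on linear paths (t/T)v. Such a path sees
a measure μ only through the mean of t ↦ μ([t,T]), so by Jensen J̄ is at most the convex conjugate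
of TG at v. With m the mean of t ↦ θ([t,T]), Sion's minimax theorem (`exists_dual_point`) provides λ
such that 2ĥ((m+λ)/2) + T G(λ) + 𝒢(θ) ≤ F(θ). A second use of Jensen, for t ↦ (λ + θ([t,T]))/2,
turns this into 2f((m+λ)/2) ≤ F(θ) (`exists_le_varianceProxy`).

Equality there forces θ([t,T]) = λ for almost every t, hence for every t > 0 by left continuity. The
value at t = 0 stays unconstrained, which is why an atom at time 0 survives in the description of
the optimal parameters. -/

noncomputable section

namespace LevyIS

/-! ### Vector measures on `[0,T]` and the pairing -/

section VectorMeasures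

variable {n : ℕ} {T : ℝ}

/-- A vector measure with values in a Euclidean space has finite total variation. -/
instance isFiniteMeasure_variation_euclidean {X : Type*} [MeasurableSpace X]
    (θ : VectorMeasure X (E n)) : IsFiniteMeasure θ.variation := by
  -- Each coordinate is a signed measure, whose variation is finite by the Jordan decomposition; the
  -- sum of these variations dominates that of θ.
  let c : Fin n → SignedMeasure X := fun i =>
    θ.mapRange (EuclideanSpace.proj i : E n →L[ℝ] ℝ).toLinearMap.toAddMonoidHom
      (EuclideanSpace.proj i : E n →L[ℝ] ℝ).continuous
  have hfin : ∀ i, IsFiniteMeasure (c i).variation := fun i => by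
    rw [← SignedMeasure.totalVariation_eq_variation]
    unfold SignedMeasure.totalVariation
    infer_instance
  have hsum : IsFiniteMeasure (∑ i, (c i).variation) := inferInstance
  refine isFiniteMeasure_of_le (∑ i, (c i).variation) ?_
  refine VectorMeasure.variation_le_of_forall_enorm_le fun A _ => ?_
  have h1 : ‖θ A‖ₑ ≤ ∑ i, ‖(θ A) i‖ₑ := by
    have : θ A = ∑ i, EuclideanSpace.single i ((θ A) i) := by
      ext j; simp [Finset.sum_apply, Pi.single_apply]
    calc ‖θ A‖ₑ = ‖∑ i, EuclideanSpace.single i ((θ A) i)‖ₑ := by rw [← this]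
      _ ≤ ∑ i, ‖EuclideanSpace.single i ((θ A) i)‖ₑ := enorm_sum_le _ _
      _ = ∑ i, ‖(θ A) i‖ₑ := by
        refine Finset.sum_congr rfl fun i _ => ?_
        simp only [enorm_eq_nnnorm, PiLp.nnnorm_single]
  rw [Measure.finsetSum_apply]
  exact h1.trans (Finset.sum_le_sum fun i _ => (c i).enorm_measure_le_variation A)

theorem pairing_dirac (hT : 0 < T) (x : LPath n T) (v : E n) :
    pairing x (VectorMeasure.dirac (finalTime hT) v) = inner ℝ (x (finalTime hT)) v := by
  rw [pairing, VectorMeasure.integral_dirac, innerSL_apply_apply]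

/-- Both sides are additive and L¹-continuous in φ, so indicators suffice. This reduces pairings
with paths of fixed direction to a vector-valued integral of a scalar function. -/
theorem integral_smul_const {X : Type*} [MeasurableSpace X] (θ : VectorMeasure X (E n))
    {φ : X → ℝ} (hφ : Integrable φ θ.variation) (w : E n) :
    θ.integral (fun t => φ t • w) (innerSL ℝ : E n →L[ℝ] E n →L[ℝ] ℝ) =
      inner ℝ w (θ.integral φ (ContinuousLinearMap.lsmul ℝ ℝ : ℝ →L[ℝ] E n →L[ℝ] E n)) := by
  refine Integrable.induction (P := fun φ : X → ℝ =>
    θ.integral (fun t => φ t • w) (innerSL ℝ : E n →L[ℝ] E n →L[ℝ] ℝ) =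
      inner ℝ w (θ.integral φ (ContinuousLinearMap.lsmul ℝ ℝ : ℝ →L[ℝ] E n →L[ℝ] E n)))
    ?_ ?_ ?_ ?_ hφ
  · intro c s hs _
    have : (fun t => (s.indicator (fun _ => c) t) • w) = s.indicator (fun _ => c • w) := by
      ext1 t; by_cases h : t ∈ s <;> simp [h]
    rw [this, VectorMeasure.integral_indicator hs, VectorMeasure.integral_indicator hs]
    simp only [map_smul, VectorMeasure.integral_const]
    exact (inner_smul_right w _ c).symm
  · intro f g _ hf hg ihf ihg
    simp only [Pi.add_apply, add_smul]
    rw [VectorMeasure.integral_fun_add (hf.smul_const w) (hg.smul_const w), ihf, ihg,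
      VectorMeasure.integral_add hf hg, inner_add_right]
  · let L := ContinuousLinearMap.toSpanSingleton ℝ w
    have h1 : Continuous fun f : X →₁[θ.variation] ℝ =>
        θ.integral (fun t => f t • w) (innerSL ℝ : E n →L[ℝ] E n →L[ℝ] ℝ) := by
      have : (fun f : X →₁[θ.variation] ℝ =>
          θ.integral (fun t => f t • w) (innerSL ℝ : E n →L[ℝ] E n →L[ℝ] ℝ)) =
          fun f => θ.integral (L.compLpL 1 θ.variation f)
            (innerSL ℝ : E n →L[ℝ] E n →L[ℝ] ℝ) := by
        ext1 f
        refine VectorMeasure.integral_congr_ae ?_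
        filter_upwards [L.coeFn_compLpL f] with t ht
        rw [ht]; simp [L]
      rw [this]
      exact VectorMeasure.continuous_integral.comp (L.compLpL 1 θ.variation).continuous
    exact isClosed_eq h1 ((continuous_const.inner VectorMeasure.continuous_integral))
  · intro f g hfg _ ih
    rw [← VectorMeasure.integral_congr_ae hfg, ← ih]
    refine VectorMeasure.integral_congr_ae ?_
    filter_upwards [hfg] with t ht
    rw [ht]

instance isFiniteMeasure_comap_Icc :
    IsFiniteMeasure (volume.comap Subtype.val : Measure (Set.Icc (0 : ℝ) T)) := by
  refine ⟨?_⟩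
  rw [(MeasurableEmbedding.subtype_coe measurableSet_Icc).comap_apply]
  exact (measure_mono (Subtype.coe_image_univ _).le).trans_lt measure_Icc_lt_top

theorem comap_volume_apply (s : Set (Set.Icc (0 : ℝ) T)) :
    (volume.comap Subtype.val : Measure (Set.Icc (0 : ℝ) T)) s =
      volume (Subtype.val '' s) :=
  (MeasurableEmbedding.subtype_coe measurableSet_Icc).comap_apply _ _

theorem stronglyMeasurable_tail (θ : M n T) :
    StronglyMeasurable fun t : Set.Icc (0 : ℝ) T => θ (Set.Ici t) := by
  have hs : MeasurableSet {p : Set.Icc (0 : ℝ) T × Set.Icc (0 : ℝ) T | p.1 ≤ p.2} :=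
    measurableSet_le measurable_fst measurable_snd
  exact VectorMeasure.stronglyMeasurable_vectorMeasure_prodMk_left (ν := θ) hs

theorem integrable_tail (θ : M n T) :
    Integrable (fun t : Set.Icc (0 : ℝ) T => θ (Set.Ici t)) (volume.comap Subtype.val) :=
  Integrable.of_bound (stronglyMeasurable_tail θ).aestronglyMeasurable θ.bound
    (Eventually.of_forall fun _ => VectorMeasure.norm_apply_le_bound)

/-- Fubini on a triangle: t is the length of [0,t], so both sides are the mass of {(s,t) : s ≤ t}
under the product of Lebesgue measure and θ. -/
theorem integral_id_eq_integral_tail (θ : M n T) :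
    θ.integral (fun t => (t : ℝ)) (ContinuousLinearMap.lsmul ℝ ℝ : ℝ →L[ℝ] E n →L[ℝ] E n) =
      ∫ t, θ (Set.Ici t) ∂(volume.comap Subtype.val) := by
  set μ : Measure (Set.Icc (0 : ℝ) T) := volume.comap Subtype.val with hμ
  set B : ℝ →L[ℝ] E n →L[ℝ] E n := ContinuousLinearMap.lsmul ℝ ℝ with hB
  have : IsFiniteMeasure μ.toSignedMeasure.variation := by
    rw [Measure.variation_toSignedMeasure]; infer_instance
  have hs : MeasurableSet {p : Set.Icc (0 : ℝ) T × Set.Icc (0 : ℝ) T | p.2 ≤ p.1} :=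
    measurableSet_le measurable_snd measurable_fst
  have hs' : MeasurableSet {p : Set.Icc (0 : ℝ) T × Set.Icc (0 : ℝ) T | p.1 ≤ p.2} :=
    measurableSet_le measurable_fst measurable_snd
  have h1 := VectorMeasure.prod_flip_apply_eq_integral (μ := θ) (ν := μ.toSignedMeasure) (B := B) hs
  have h2 := VectorMeasure.prod_apply_eq_integral (μ := μ.toSignedMeasure) (ν := θ) (B := B) hs'
  have h3 : (θ.prod μ.toSignedMeasure B.flip) {p | p.2 ≤ p.1} =
      (μ.toSignedMeasure.prod θ B) {p | p.1 ≤ p.2} := by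
    have : θ.prod μ.toSignedMeasure B.flip =
        (μ.toSignedMeasure.prod θ B).map Prod.swap := by
      refine VectorMeasure.prod_eq_of_forall_apply_prod fun s t hs ht => ?_
      rw [VectorMeasure.map_apply _ measurable_swap (hs.prod ht)]
      simp
    rw [this, VectorMeasure.map_apply _ measurable_swap hs]
    rfl
  have h4 : ∀ x : Set.Icc (0 : ℝ) T,
      μ.toSignedMeasure (Prod.mk x ⁻¹' {p : Set.Icc (0 : ℝ) T × Set.Icc (0 : ℝ) T | p.2 ≤ p.1}) =
        (x : ℝ) := fun x => by
    have : Prod.mk x ⁻¹' {p : Set.Icc (0 : ℝ) T × Set.Icc (0 : ℝ) T | p.2 ≤ p.1} = Set.Iic x := rfl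
    rw [this, Measure.toSignedMeasure_apply_measurable measurableSet_Iic, measureReal_def, hμ,
      comap_volume_apply]
    have : Subtype.val '' (Set.Iic x) = Set.Icc (0 : ℝ) x := by
      ext y
      simp only [Set.mem_image, Set.mem_Iic, Subtype.exists, exists_and_right, exists_eq_right,
        Set.mem_Icc]
      exact ⟨fun ⟨h, h'⟩ => ⟨h.1, h'⟩, fun h => ⟨⟨h.1, h.2.trans x.2.2⟩, h.2⟩⟩
    rw [this, Real.volume_Icc, sub_zero, ENNReal.toReal_ofReal x.2.1]
  simp_rw [h4] at h1
  rw [← h1, h3, h2]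
  exact VectorMeasure.integral_toSignedMeasure

theorem pairing_linear (θ : M n T) (w : E n) :
    pairing (fun t => (t : ℝ) • w) θ =
      inner ℝ w (∫ t, θ (Set.Ici t) ∂(volume.comap Subtype.val)) := by
  rw [← integral_id_eq_integral_tail]
  refine integral_smul_const θ (Integrable.of_bound (C := T) ?_ ?_) w
  · exact measurable_subtype_coe.aestronglyMeasurable
  · exact Eventually.of_forall fun t => by
      rw [Real.norm_of_nonneg t.2.1]; exact t.2.2

theorem pairing_const_add_indicator (θ : M n T) (w u : E n) {s : Set (Set.Icc (0 : ℝ) T)}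
    (hs : MeasurableSet s) :
    pairing (fun t => w + s.indicator (fun _ => (1 : ℝ)) t • u) θ =
      inner ℝ w (θ Set.univ) + inner ℝ u (θ s) := by
  have : (fun t => w + s.indicator (fun _ => (1 : ℝ)) t • u) =
      fun t => (fun _ => w) t + s.indicator (fun _ => u) t := by
    ext1 t; by_cases h : t ∈ s <;> simp [h]
  rw [pairing, this, VectorMeasure.integral_fun_add (integrable_const _)
    ((integrable_const u).indicator hs), VectorMeasure.integral_indicator hs]
  simp
  rfl

/-- Vector measures on `[0,T]` are determined by their values on the intervals `[t,T]`. -/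
theorem ext_of_tail (hT : 0 < T) {θ η : M n T} (h : ∀ t, θ (Set.Ici t) = η (Set.Ici t)) :
    θ = η := by
  refine VectorMeasure.ext_of_generateFrom (Set.range Set.Ici) ?_
    (BorelSpace.measurable_eq.trans (borel_eq_generateFrom_Ici (Set.Icc (0 : ℝ) T))) ?_ ?_
  · rintro _ ⟨t, rfl⟩; exact h t
  · rintro _ ⟨a, rfl⟩ _ ⟨b, rfl⟩ _
    exact ⟨a ⊔ b, by rw [Set.Ici_inter_Ici]⟩
  · have : (Set.univ : Set (Set.Icc (0 : ℝ) T)) = Set.Ici (initTime hT) := by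
      ext t; exact ⟨fun _ => t.2.1, fun _ => trivial⟩
    rw [this, h]

theorem dirac_tail (hT : 0 < T) (v : E n) (t : Set.Icc (0 : ℝ) T) :
    VectorMeasure.dirac (finalTime hT) v (Set.Ici t) = v := by
  rw [VectorMeasure.dirac_apply_of_mem measurableSet_Ici]
  exact t.2.2

/-- `t ↦ θ([t,T])` is left-continuous at every time `t > 0`: if it is a.e. equal to `v`, it is equal
to `v` on `(0,T]`. -/
theorem tail_eq_of_ae_eq (θ : M n T) {v : E n}
    (h : ∀ᵐ t ∂(volume.comap Subtype.val : Measure (Set.Icc (0 : ℝ) T)), θ (Set.Ici t) = v)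
    (t : Set.Icc (0 : ℝ) T) (ht : 0 < (t : ℝ)) : θ (Set.Ici t) = v := by
  -- A set of full measure meets every interval (a,t), so t is a limit of good times from the left;
  -- σ-additivity along [s_k,T] ↓ [t,T] then passes the value to t.
  have key : ∀ a : ℝ, 0 ≤ a → a < t →
      ∃ s : Set.Icc (0 : ℝ) T, a < s ∧ (s : ℝ) < t ∧ θ (Set.Ici s) = v := by
    intro a ha hat
    by_contra! hcon
    have hsub : Set.Ioo a (t : ℝ) ⊆
        Subtype.val '' {s : Set.Icc (0 : ℝ) T | ¬ θ (Set.Ici s) = v} := fun y hy =>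
      ⟨⟨y, ha.trans hy.1.le, hy.2.le.trans t.2.2⟩, hcon ⟨y, _⟩ hy.1 hy.2, rfl⟩
    have h0 : volume (Subtype.val '' {s : Set.Icc (0 : ℝ) T | ¬ θ (Set.Ici s) = v}) = 0 := by
      rw [← comap_volume_apply]; exact h
    have := measure_mono_null hsub h0
    rw [Real.volume_Ioo, ENNReal.ofReal_eq_zero] at this
    linarith
  have hlub : IsLUB {s : Set.Icc (0 : ℝ) T | s < t ∧ θ (Set.Ici s) = v} t := by
    refine ⟨fun s hs => hs.1.le, fun b hb => ?_⟩
    by_contra! hbt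
    obtain ⟨s, hs, hst, hsv⟩ := key b b.2.1 hbt
    exact absurd (hb ⟨hst, hsv⟩) (not_le.2 hs)
  have hne : {s : Set.Icc (0 : ℝ) T | s < t ∧ θ (Set.Ici s) = v}.Nonempty := by
    obtain ⟨s, -, hst, hsv⟩ := key 0 le_rfl ht
    exact ⟨s, hst, hsv⟩
  obtain ⟨s, hs_mono, -, hs_lim, hs⟩ :=
    hlub.exists_seq_strictMono_tendsto_of_notMem (fun h => lt_irrefl _ h.1) hne
  have hInter : (⋂ k, Set.Ici (s k)) = Set.Ici t := by
    ext y
    simp only [Set.mem_iInter, Set.mem_Ici]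
    exact ⟨fun hy => le_of_tendsto' hs_lim hy, fun hy k => (hs k).1.le.trans hy⟩
  have hlim : Tendsto (fun k => θ (Set.Ici (s k))) atTop (𝓝 (θ (Set.Ici t))) := by
    rw [← hInter]
    exact θ.tendsto_vectorMeasure_iInter_atTop_nat
      (fun i j hij => Set.Ici_subset_Ici.2 (hs_mono.monotone hij)) fun _ => measurableSet_Ici
  simp_rw [(hs _).2] at hlim
  exact (tendsto_nhds_unique hlim tendsto_const_nhds)

end VectorMeasures

/-! ### Paths of bounded variation -/

section Paths

variable {n : ℕ} {T : ℝ}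

theorem boundedVariationOn_of_monotone (hT : 0 < T) {φ : Set.Icc (0 : ℝ) T → ℝ}
    (hφ : Monotone φ) : BoundedVariationOn φ Set.univ := by
  have h := (hφ.monotoneOn Set.univ).locallyBoundedVariationOn (initTime hT) (finalTime hT)
    (Set.mem_univ _) (Set.mem_univ _)
  exact h.mono fun t _ => ⟨trivial, t.2.1, t.2.2⟩

theorem const_add_smul_mem_Vr {φ : Set.Icc (0 : ℝ) T → ℝ} (hφ : BoundedVariationOn φ Set.univ)
    (hr : ∀ t, ContinuousWithinAt φ (Set.Ici t) t) (w u : E n) :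
    (fun t => w + φ t • u) ∈ Vr n T := by
  have hL : LipschitzWith ‖u‖₊ fun r : ℝ => w + r • u :=
    LipschitzWith.of_dist_le_mul fun a b => by
      rw [dist_add_left, dist_eq_norm, ← sub_smul, norm_smul, mul_comm, ← dist_eq_norm]; rfl
  have hBV : BoundedVariationOn (fun t => w + φ t • u) Set.univ :=
    hL.comp_boundedVariationOn hφ
  refine ⟨fun t => ⟨(hL.continuous.continuousAt.comp_continuousWithinAt (hr t)), ?_⟩, hBV⟩
  simpa using hBV.exists_tendsto_left t

theorem const_mem_Vr (hT : 0 < T) (w : E n) : (fun _ => w) ∈ Vr n T := by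
  simpa using const_add_smul_mem_Vr (n := n)
    (boundedVariationOn_of_monotone hT (φ := fun _ => 0) monotone_const)
    (fun t => continuousWithinAt_const) w 0

theorem linear_mem_Vr (hT : 0 < T) (w : E n) :
    (fun t : Set.Icc (0 : ℝ) T => (t : ℝ) • w) ∈ Vr n T := by
  simpa using const_add_smul_mem_Vr (n := n)
    (boundedVariationOn_of_monotone hT (φ := fun t => (t : ℝ)) fun a b h => h)
    (fun t => continuous_subtype_val.continuousWithinAt) 0 w

/-- These test paths move away from w on [s,T) and return to w at T, so the payoff does not notice
the excursion. -/
theorem indicator_Ico_mem_Vr (hT : 0 < T) (s : Set.Icc (0 : ℝ) T) (w u : E n) :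
    (fun t => w + (Set.Ico s (finalTime hT)).indicator (fun _ => (1 : ℝ)) t • u) ∈ Vr n T := by
  have hmono : ∀ r : Set.Icc (0 : ℝ) T, Monotone ((Set.Ici r).indicator fun _ => (1 : ℝ)) :=
    fun r a b hab => by
      by_cases ha : r ≤ a
      · simp [ha, ha.trans hab]
      · rw [Set.indicator_of_notMem (by simpa using ha)]
        exact Set.indicator_nonneg (fun _ _ => zero_le_one) _
  have hcont : ∀ r t : Set.Icc (0 : ℝ) T,
      ContinuousWithinAt ((Set.Ici r).indicator fun _ => (1 : ℝ)) (Set.Ici t) t := fun r t => by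
    by_cases h : r ≤ t
    · refine (continuousWithinAt_const (b := (1 : ℝ))).congr (fun y hy => ?_) ?_
      · exact Set.indicator_of_mem (Set.mem_Ici.2 (h.trans hy)) _
      · exact Set.indicator_of_mem (Set.mem_Ici.2 h) _
    · refine ContinuousAt.continuousWithinAt ?_
      refine (continuousAt_const (y := (0 : ℝ))).congr ?_
      filter_upwards [Iio_mem_nhds (not_le.1 h)] with y hy
      exact (Set.indicator_of_notMem (not_le.2 hy) _).symm
  have heq : (Set.Ico s (finalTime hT)).indicator (fun _ => (1 : ℝ)) = fun t =>
      (Set.Ici s).indicator (fun _ => (1 : ℝ)) t *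
        (1 + -1 * (Set.Ici (finalTime hT)).indicator (fun _ => (1 : ℝ)) t) := by
    ext1 t
    by_cases h1 : s ≤ t <;> by_cases h2 : finalTime hT ≤ t <;>
      simp [Set.indicator, h1, h2, not_lt.2, not_le.1]
  have hlip : LipschitzWith 1 fun r : ℝ => 1 + -1 * r :=
    LipschitzWith.of_dist_le_mul fun a b => by
      rw [Real.dist_eq, Real.dist_eq, NNReal.coe_one, one_mul, abs_sub_comm a b]
      exact le_of_eq (by congr 1; ring)
  refine const_add_smul_mem_Vr ?_ (fun t => ?_) w u
  · rw [heq]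
    exact (boundedVariationOn_of_monotone hT (hmono s)).fun_mul
      (hlip.comp_boundedVariationOn (boundedVariationOn_of_monotone hT (hmono (finalTime hT))))
  · rw [heq]
    exact (hcont s t).mul
      (continuousWithinAt_const.add (continuousWithinAt_const.mul (hcont (finalTime hT) t)))

/-- A right-continuous function on the real line is measurable. -/
theorem measurable_of_rightContinuous {F : Type*} [TopologicalSpace F]
    [TopologicalSpace.PseudoMetrizableSpace F] [MeasurableSpace F] [BorelSpace F] {x : ℝ → F}
    (hx : ∀ t, ContinuousWithinAt x (Set.Ici t) t) : Measurable x := by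
  -- The least point of the grid ℤ/(k+1) strictly to the right of t: it takes countably many values
  -- and tends to t from the right.
  let r : ℕ → ℝ → ℝ := fun k t => ((⌊((k : ℝ) + 1) * t⌋ : ℝ) + 1) / ((k : ℝ) + 1)
  have hpos : ∀ k : ℕ, (0 : ℝ) < (k : ℝ) + 1 := fun k => by positivity
  refine measurable_of_tendsto_metrizable (f := fun k t => x (r k t)) (fun k => ?_) ?_
  · exact (measurable_from_top (f := fun m : ℤ => x (((m : ℝ) + 1) / ((k : ℝ) + 1)))).comp
      (Int.measurable_floor.comp (measurable_const.mul measurable_id))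
  · rw [tendsto_pi_nhds]
    intro t
    have hle : ∀ k, t ≤ r k t := fun k => by
      rw [le_div_iff₀ (hpos k), mul_comm]
      exact (Int.lt_floor_add_one _).le
    have hle' : ∀ k, r k t ≤ t + 1 / ((k : ℝ) + 1) := fun k => by
      have : (t + 1 / ((k : ℝ) + 1)) * ((k : ℝ) + 1) = ((k : ℝ) + 1) * t + 1 := by
        have := (hpos k).ne'
        field_simp
      rw [div_le_iff₀ (hpos k), this]
      linarith [Int.floor_le (((k : ℝ) + 1) * t)]
    have hlim : Tendsto (fun k => r k t) atTop (𝓝 t) := by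
      refine tendsto_of_tendsto_of_tendsto_of_le_of_le tendsto_const_nhds ?_ hle hle'
      simpa using tendsto_const_nhds.add (tendsto_one_div_add_atTop_nhds_zero_nat (𝕜 := ℝ))
    exact (hx t).tendsto.comp
      (tendsto_nhdsWithin_iff.2 ⟨hlim, Eventually.of_forall hle⟩)

theorem rightContinuous_projIcc (hT : 0 < T) {x : LPath n T} (hx : x ∈ Vr n T) (t : ℝ) :
    ContinuousWithinAt (fun s => x (Set.projIcc 0 T hT.le s)) (Set.Ici t) t :=
  ((hx.1 (Set.projIcc 0 T hT.le t)).1).comp continuous_projIcc.continuousWithinAt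
    fun _ hs => Set.monotone_projIcc hT.le hs

theorem measurable_of_mem_Vr (hT : 0 < T) {x : LPath n T} (hx : x ∈ Vr n T) : Measurable x := by
  have h := (measurable_of_rightContinuous (rightContinuous_projIcc hT hx)).comp
    (measurable_subtype_coe (p := fun t => t ∈ Set.Icc (0 : ℝ) T))
  convert h using 1
  ext1 t
  simp [Set.projIcc_val]

theorem exists_bound_of_mem_Vr (hT : 0 < T) {x : LPath n T} (hx : x ∈ Vr n T) :
    ∃ C, ∀ t, ‖x t‖ ≤ C := by
  refine ⟨‖x (initTime hT)‖ + (eVariationOn x Set.univ).toReal, fun t => ?_⟩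
  have h := hx.2.dist_le (Set.mem_univ t) (Set.mem_univ (initTime hT))
  rw [dist_eq_norm] at h
  calc ‖x t‖ = ‖x (initTime hT) + (x t - x (initTime hT))‖ := by congr 1; abel
    _ ≤ _ := (norm_add_le _ _).trans (by gcongr)

theorem integrable_of_mem_Vr (hT : 0 < T) {x : LPath n T} (hx : x ∈ Vr n T) (θ : M n T) :
    Integrable x θ.variation := by
  obtain ⟨C, hC⟩ := exists_bound_of_mem_Vr hT hx
  exact Integrable.of_bound (measurable_of_mem_Vr hT hx).aestronglyMeasurable C
    (Eventually.of_forall hC)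

theorem pairing_sub_measure (hT : 0 < T) {x : LPath n T} (hx : x ∈ Vr n T) (θ η : M n T) :
    pairing x (θ - η) = pairing x θ - pairing x η :=
  VectorMeasure.integral_sub_vectorMeasure (integrable_of_mem_Vr hT hx θ)
    (integrable_of_mem_Vr hT hx η)

end Paths

/-! ### The hypotheses of the duality theorem for European log-payoffs -/

section Duality

variable {n : ℕ} {T : ℝ}

/-- The averages of `z` over the intervals `[t, t + 1/(k+1)]`. -/
def rightAverage {n : ℕ} (z : ℝ → E n) (k : ℕ) (t : ℝ) : E n :=
  ((k : ℝ) + 1) • ∫ s in t..(t + 1 / ((k : ℝ) + 1)), z s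

/-- Used three ways: with small ε for convergence, with w = 0 for a uniform bound, and with ε = 0 at
time T, beyond which the extended path is constant. -/
theorem norm_rightAverage_sub_le {z : ℝ → E n} (hz : ∀ a b, IntervalIntegrable z volume a b)
    (k : ℕ) (t : ℝ) (w : E n) {ε : ℝ}
    (h : ∀ s ∈ Set.Icc t (t + 1 / ((k : ℝ) + 1)), ‖z s - w‖ ≤ ε) :
    ‖rightAverage z k t - w‖ ≤ ε := by
  have hk : (0 : ℝ) < (k : ℝ) + 1 := by positivity
  have hk' : (0 : ℝ) < 1 / ((k : ℝ) + 1) := by positivity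
  have : rightAverage z k t - w =
      ((k : ℝ) + 1) • ∫ s in t..(t + 1 / ((k : ℝ) + 1)), (z s - w) := by
    rw [intervalIntegral.integral_sub (hz _ _) intervalIntegrable_const, smul_sub,
      intervalIntegral.integral_const, add_sub_cancel_left, smul_smul, mul_one_div_cancel hk.ne',
      one_smul]
    rfl
  rw [this, norm_smul, Real.norm_of_nonneg hk.le]
  have h2 := intervalIntegral.norm_integral_le_of_norm_le_const (a := t)
    (b := t + 1 / ((k : ℝ) + 1)) (f := fun s => z s - w) (C := ε) fun s hs => by
      rw [Set.uIoc_of_le (by linarith)] at hs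
      exact h s ⟨hs.1.le, hs.2⟩
  rw [add_sub_cancel_left, abs_of_pos hk'] at h2
  calc ((k : ℝ) + 1) * _ ≤ ((k : ℝ) + 1) * (ε * (1 / ((k : ℝ) + 1))) := by gcongr
    _ = ε := by field_simp

theorem tendsto_rightAverage {z : ℝ → E n} (hz : ∀ a b, IntervalIntegrable z volume a b) {t : ℝ}
    (ht : ContinuousWithinAt z (Set.Ici t) t) :
    Tendsto (fun k => rightAverage z k t) atTop (𝓝 (z t)) := by
  rw [Metric.tendsto_nhds]
  intro ε hε
  rw [ContinuousWithinAt, Metric.tendsto_nhdsWithin_nhds] at ht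
  obtain ⟨δ, hδ, h⟩ := ht (ε / 2) (half_pos hε)
  filter_upwards [(tendsto_one_div_add_atTop_nhds_zero_nat (𝕜 := ℝ)).eventually_lt_const hδ]
    with k hk
  rw [dist_eq_norm]
  refine (norm_rightAverage_sub_le hz k t (z t) (ε := ε / 2) fun s hs => ?_).trans_lt
    (half_lt_self hε)
  rw [← dist_eq_norm]
  refine (h hs.1 ?_).le
  rw [Real.dist_eq, abs_of_nonneg (sub_nonneg.2 hs.1)]
  linarith [hs.2]

/-- Right averages converge pointwise by right continuity and are uniformly bounded, so dominated
convergence handles every θ. Extending x by its end value makes the average at T exact. -/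
theorem exists_Vac_approximation (hT : 0 < T) {x : LPath n T} (hx : x ∈ Vr n T) :
    ∃ y : ℕ → LPath n T, (∀ k, (fun t => y k t - x (initTime hT)) ∈ Vac n T) ∧
      SigmaTendsto y x ∧ ∀ k, y k (finalTime hT) = x (finalTime hT) := by
  set z : ℝ → E n := fun s => x (Set.projIcc 0 T hT.le s) with hz_def
  obtain ⟨C, hC⟩ := exists_bound_of_mem_Vr hT hx
  have hC0 : 0 ≤ C := (norm_nonneg _).trans (hC (initTime hT))
  have hz_meas : Measurable z := measurable_of_rightContinuous (rightContinuous_projIcc hT hx)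
  have hz : ∀ a b, IntervalIntegrable z volume a b := fun a b =>
    (intervalIntegrable_const (c := C)).mono_fun hz_meas.aestronglyMeasurable
      (Eventually.of_forall fun s => by
        rw [Real.norm_of_nonneg hC0]; exact hC _)
  have hz0 : z 0 = x (initTime hT) := by
    simp only [hz_def]; congr 1; exact Set.projIcc_left hT.le
  have hz_val : ∀ t : Set.Icc (0 : ℝ) T, z t = x t := fun t => by
    simp only [hz_def, Set.projIcc_val]
  let c : ℕ → E n := fun k => rightAverage z k 0 - x (initTime hT)
  -- The linear correction restores the starting point, vanishes at T, and tends to 0 because `c k`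
  -- does.
  let y : ℕ → LPath n T := fun k t => rightAverage z k t - (1 - (t : ℝ) / T) • c k
  -- The velocity of `y k`: the difference quotient of z plus the slope of the correction.
  let g : ℕ → ℝ → E n := fun k s =>
    ((k : ℝ) + 1) • (z (s + 1 / ((k : ℝ) + 1)) - z s) + (1 / T) • c k
  have hz' : ∀ (k : ℕ) a b,
      IntervalIntegrable (fun s => z (s + 1 / ((k : ℝ) + 1))) volume a b := fun k a b =>
    (intervalIntegrable_const (c := C)).mono_fun
      (hz_meas.comp (measurable_id.add_const _)).aestronglyMeasurable
      (Eventually.of_forall fun s => by rw [Real.norm_of_nonneg hC0]; exact hC _)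
  have hg : ∀ k a b, IntervalIntegrable (g k) volume a b := fun k a b =>
    (((hz' k a b).sub (hz a b)).smul ((k : ℝ) + 1)).add intervalIntegrable_const
  have hyg : ∀ k (t : Set.Icc (0 : ℝ) T), y k t - x (initTime hT) = ∫ s in (0 : ℝ)..t, g k s := by
    intro k t
    have h1 : ∫ s in (0 : ℝ)..t, g k s = ((k : ℝ) + 1) •
        ((∫ s in (0 + 1 / ((k : ℝ) + 1))..(t + 1 / ((k : ℝ) + 1)), z s) -
          ∫ s in (0 : ℝ)..t, z s) + ((t : ℝ) / T) • c k := by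
      simp only [g]
      have hsub : IntervalIntegrable
          (fun s => ((k : ℝ) + 1) • (z (s + 1 / ((k : ℝ) + 1)) - z s)) volume 0 t :=
        ((hz' k _ _).sub (hz _ _)).smul ((k : ℝ) + 1)
      rw [intervalIntegral.integral_add hsub intervalIntegrable_const, intervalIntegral.integral_const, intervalIntegral.integral_smul,
        intervalIntegral.integral_sub (hz' k _ _) (hz _ _),
        intervalIntegral.integral_comp_add_right, sub_zero, smul_smul, mul_one_div]
    have h2 : (∫ s in (0 + 1 / ((k : ℝ) + 1))..(t + 1 / ((k : ℝ) + 1)), z s) -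
        (∫ s in (0 : ℝ)..t, z s) = (∫ s in (t : ℝ)..(t + 1 / ((k : ℝ) + 1)), z s) -
          ∫ s in (0 : ℝ)..(0 + 1 / ((k : ℝ) + 1)), z s := by
      have e1 := intervalIntegral.integral_add_adjacent_intervals
        (hz 0 (0 + 1 / ((k : ℝ) + 1))) (hz (0 + 1 / ((k : ℝ) + 1)) (t + 1 / ((k : ℝ) + 1)))
      have e2 := intervalIntegral.integral_add_adjacent_intervals
        (hz 0 t) (hz t (t + 1 / ((k : ℝ) + 1)))
      rw [← e2] at e1
      rw [eq_sub_of_add_eq' e1]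
      abel
    rw [h1, h2, smul_sub]
    simp only [y, c, rightAverage]
    module
  have hbound : ∀ k t, ‖rightAverage z k t‖ ≤ C := fun k t => by
    simpa using norm_rightAverage_sub_le hz k t 0 (ε := C) fun s _ => by simpa using hC _
  refine ⟨y, fun k => ⟨g k, ?_, hyg k⟩, fun θ => ?_, fun k => ?_⟩
  · rw [integrableOn_Icc_iff_integrableOn_Ioc, ← intervalIntegrable_iff_integrableOn_Ioc_of_le hT.le]
    exact hg k 0 T
  · refine VectorMeasure.tendsto_integral_filter_of_norm_le_const
      (Eventually.of_forall fun k => ?_) ⟨C + (C + C), Eventually.of_forall fun k =>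
        Eventually.of_forall fun t => ?_⟩ (Eventually.of_forall fun t => ?_)
    · have : y k = fun t : Set.Icc (0 : ℝ) T =>
          x (initTime hT) + ∫ s in (0 : ℝ)..t, g k s := by
        ext1 t; rw [← hyg]; abel
      change AEStronglyMeasurable (y k) _
      rw [this]
      refine Continuous.aestronglyMeasurable ?_
      exact continuous_const.add ((intervalIntegral.continuous_primitive (hg k) 0).comp
        continuous_subtype_val)
    · have h01 : ‖1 - (t : ℝ) / T‖ ≤ 1 := by
        have h1 : (t : ℝ) / T ≤ 1 := (div_le_one hT).2 t.2.2
        have h0 : 0 ≤ (t : ℝ) / T := div_nonneg t.2.1 hT.le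
        rw [Real.norm_of_nonneg (by linarith)]; linarith
      calc ‖y k t‖ ≤ ‖rightAverage z k t‖ + ‖(1 - (t : ℝ) / T) • c k‖ := norm_sub_le _ _
        _ ≤ C + 1 * (C + C) := by
          rw [norm_smul]
          gcongr
          · exact hbound k t
          · exact (norm_sub_le _ _).trans (add_le_add (hbound k 0) (hC _))
        _ = _ := by rw [one_mul]
    · have hc : Tendsto c atTop (𝓝 0) := by
        have := (tendsto_rightAverage hz (rightContinuous_projIcc hT hx 0)).sub_const
          (x (initTime hT))
        rw [hz0, sub_self] at this
        exact this
      have h1 := tendsto_rightAverage hz (rightContinuous_projIcc hT hx t)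
      rw [hz_val] at h1
      simpa using h1.sub (hc.const_smul (1 - (t : ℝ) / T))
  · have h1 : rightAverage z k T = x (finalTime hT) := by
      rw [← sub_eq_zero, ← norm_le_zero_iff]
      refine norm_rightAverage_sub_le hz k T _ fun s hs => ?_
      have : z s = x (finalTime hT) := by
        simp only [hz_def]; congr 1; exact Set.projIcc_of_right_le hT.le hs.1
      rw [this, sub_self, norm_zero]
    have h2 : ((finalTime hT : Set.Icc (0 : ℝ) T) : ℝ) = T := rfl
    simp only [y, h2, h1, div_self hT.ne', sub_self, zero_smul, sub_zero]

/-- Only the end value enters H. It is 1-Lipschitz for the norm of the velocity, and the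
approximating paths keep it exactly. -/
theorem dualityHypotheses_european (hT : 0 < T) {G h : E n → EReal}
    (h_concave : EConcaveOn Set.univ h) (h_usc : UpperSemicontinuous h) (hA2 : AssumptionA2 G) :
    DualityHypotheses hT G (europeanLogPayoff hT h) where
  concave x _ y _ a b ha hb hab :=
    h_concave (x (finalTime hT)) trivial (y (finalTime hT)) trivial a b ha hb hab
  usc x _ c hc := by
    obtain ⟨δ, hδ, hball⟩ := Metric.eventually_nhds_iff.1 (h_usc (x (finalTime hT)) c hc)
    refine ⟨δ, hδ, fun y _ g hg hgδ => hball ?_⟩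
    have h1 := hg.2 (finalTime hT)
    rw [Pi.sub_apply] at h1
    rw [dist_eq_norm, h1]
    exact (intervalIntegral.norm_integral_le_integral_norm hT.le).trans_lt hgδ
  approx x hx := by
    obtain ⟨y, hy, hlim, hfin⟩ := exists_Vac_approximation hT hx
    refine ⟨y, hy, hlim, ?_⟩
    simp only [europeanLogPayoff, hfin]
    exact tendsto_const_nhds
  a2 := hA2

end Duality

/-! ### Cumulant generating functions -/

section Cumulant

variable {n : ℕ}

/-- The properties of the cumulant generating function that the duality argument uses. -/
structure IsProperCumulant (G : E n → EReal) : Prop where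
  lsc : LowerSemicontinuous G
  bounded : Bornology.IsBounded {lam | G lam < ⊤}
  convex : EConvexOn Set.univ G
  ne_bot : ∀ lam, G lam ≠ ⊥
  zero : G 0 = 0
  midpoint_lt : ∀ lam mu, lam ≠ mu → G lam < ⊤ → G mu < ⊤ →
    2 * G ((1 / 2 : ℝ) • lam + (1 / 2 : ℝ) • mu) < G lam + G mu

/-- Lower semicontinuity gives a minimum on a closed ball containing the effective domain; elsewhere
G is ⊤. -/
theorem IsProperCumulant.exists_le {G : E n → EReal} (hG : IsProperCumulant G) :
    ∃ C : ℝ, 0 ≤ C ∧ ∀ lam, ((-C : ℝ) : EReal) ≤ G lam := by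
  obtain ⟨R, hR⟩ := hG.bounded.subset_closedBall 0
  have hne : (Metric.closedBall (0 : E n) R).Nonempty :=
    ⟨0, hR (show G 0 < ⊤ by rw [hG.zero]; exact EReal.zero_lt_top)⟩
  obtain ⟨a, -, ha⟩ := (hG.lsc.lowerSemicontinuousOn _).exists_isMinOn hne
    (isCompact_closedBall (0 : E n) R)
  have hle : ∀ lam, G a ≤ G lam := fun lam => by
    by_cases h : G lam < ⊤
    · exact ha (hR h)
    · rw [not_lt_top_iff.1 h]; exact le_top
  have hat : G a ≠ ⊤ := ((hle 0).trans_lt (by rw [hG.zero]; exact EReal.zero_lt_top)).ne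
  refine ⟨|(G a).toReal|, abs_nonneg _, fun lam => le_trans ?_ (hle lam)⟩
  rw [← EReal.coe_toReal hat (hG.ne_bot a), EReal.toReal_coe]
  exact EReal.coe_le_coe_iff.2 (neg_abs_le _)

variable {Ω : Type*} [MeasurableSpace Ω] (P : Measure Ω)
  {X : ℝ≥0 → Ω → E n}

theorem measurable_inner_increment (hX : Measurable (X 1)) (lam : E n) :
    Measurable fun ω => (inner ℝ lam (X 1 ω) : ℝ) :=
  measurable_const.inner hX

theorem measurable_exp_inner (hX : Measurable (X 1)) (lam : E n) :
    Measurable fun ω => Real.exp (inner ℝ lam (X 1 ω)) :=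
  Real.measurable_exp.comp (measurable_inner_increment hX lam)

theorem cumulant_ne_bot [IsProbabilityMeasure P] (hX : Measurable (X 1)) (lam : E n) : cumulant X P lam ≠ ⊥ := by
  intro h
  rw [cumulant, ENNReal.log_eq_bot_iff,
    lintegral_eq_zero_iff (measurable_exp_inner hX lam).ennreal_ofReal] at h
  have : ∀ᵐ ω ∂P, False := by
    filter_upwards [h] with ω hω
    simp only [Pi.zero_apply, ENNReal.ofReal_eq_zero] at hω
    exact absurd hω (not_le.2 (Real.exp_pos _))
  exact IsProbabilityMeasure.ne_zero P (by simpa using this)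

theorem cumulant_zero [IsProbabilityMeasure P] : cumulant X P 0 = 0 := by
  simp [cumulant]

/-- The logarithm of Hölder's inequality with exponents 1/a and 1/b. -/
theorem cumulant_convex (hX : Measurable (X 1)) : EConvexOn Set.univ (cumulant X P) := by
  intro x _ y _ a b ha hb hab
  have hle : ∫⁻ ω, ENNReal.ofReal (Real.exp (inner ℝ (a • x + b • y) (X 1 ω))) ∂P ≤
      (∫⁻ ω, ENNReal.ofReal (Real.exp (inner ℝ x (X 1 ω))) ∂P) ^ a *
        (∫⁻ ω, ENNReal.ofReal (Real.exp (inner ℝ y (X 1 ω))) ∂P) ^ b := by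
    refine le_trans (le_of_eq ?_) (ENNReal.lintegral_mul_norm_pow_le
      (measurable_exp_inner hX x).ennreal_ofReal.aemeasurable
      (measurable_exp_inner hX y).ennreal_ofReal.aemeasurable ha.le hb.le hab)
    refine lintegral_congr fun ω => ?_
    rw [ENNReal.ofReal_rpow_of_pos (Real.exp_pos _), ENNReal.ofReal_rpow_of_pos (Real.exp_pos _),
      ← ENNReal.ofReal_mul (Real.rpow_nonneg (Real.exp_pos _).le _), ← Real.exp_mul, ← Real.exp_mul,
      ← Real.exp_add, inner_add_left, real_inner_smul_left, real_inner_smul_left, mul_comm a,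
      mul_comm b]
  have := ENNReal.log_monotone hle
  rwa [ENNReal.log_mul_add, ENNReal.log_rpow, ENNReal.log_rpow] at this

theorem cumulant_lt_top_iff (hX : Measurable (X 1)) (lam : E n) :
    cumulant X P lam < ⊤ ↔ Integrable (fun ω => Real.exp (inner ℝ lam (X 1 ω))) P := by
  rw [cumulant, lt_top_iff_ne_top, Ne, ENNReal.log_eq_top_iff, ← Ne, ← lt_top_iff_ne_top]
  constructor
  · intro h
    exact (lintegral_ofReal_ne_top_iff_integrable (measurable_exp_inner hX lam).aestronglyMeasurable
      (Eventually.of_forall fun _ => (Real.exp_pos _).le)).1 h.ne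
  · intro h
    exact h.lintegral_lt_top

theorem cumulant_eq_log [IsProbabilityMeasure P] (hX : Measurable (X 1)) {lam : E n}
    (h : cumulant X P lam < ⊤) :
    0 < ∫ ω, Real.exp (inner ℝ lam (X 1 ω)) ∂P ∧
      cumulant X P lam = (Real.log (∫ ω, Real.exp (inner ℝ lam (X 1 ω)) ∂P) : ℝ) := by
  have hi := (cumulant_lt_top_iff P hX lam).1 h
  have hpos : 0 < ∫ ω, Real.exp (inner ℝ lam (X 1 ω)) ∂P := integral_exp_pos hi
  refine ⟨hpos, ?_⟩
  rw [cumulant, ← ofReal_integral_eq_lintegral_ofReal hi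
    (Eventually.of_forall fun _ => (Real.exp_pos _).le), ENNReal.log_ofReal, if_neg hpos.not_ge]

/-- Equality would be equality in Cauchy–Schwarz, forcing ⟨lam − mu, X₁⟩ to be almost surely
constant. Then the whole line through lam − mu lies in the effective domain, which is bounded. -/
theorem cumulant_midpoint_lt [IsProbabilityMeasure P] (hX : Measurable (X 1))
    (hbdd : Bornology.IsBounded {lam | cumulant X P lam < ⊤}) (lam mu : E n) (hne : lam ≠ mu)
    (hlam : cumulant X P lam < ⊤) (hmu : cumulant X P mu < ⊤) :
    2 * cumulant X P ((1 / 2 : ℝ) • lam + (1 / 2 : ℝ) • mu) <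
      cumulant X P lam + cumulant X P mu := by
  set mid := (1 / 2 : ℝ) • lam + (1 / 2 : ℝ) • mu with hmid_def
  obtain ⟨hp, hGp⟩ := cumulant_eq_log P hX hlam
  obtain ⟨hq, hGq⟩ := cumulant_eq_log P hX hmu
  have hmid : cumulant X P mid < ⊤ := by
    refine (cumulant_convex P hX lam trivial mu trivial (1 / 2) (1 / 2) (by norm_num)
      (by norm_num) (by norm_num)).trans_lt ?_
    rw [hGp, hGq, ← EReal.coe_mul, ← EReal.coe_mul, ← EReal.coe_add]
    exact EReal.coe_lt_top _
  obtain ⟨hr, hGr⟩ := cumulant_eq_log P hX hmid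
  have hip := (cumulant_lt_top_iff P hX lam).1 hlam
  have hiq := (cumulant_lt_top_iff P hX mu).1 hmu
  have hir := (cumulant_lt_top_iff P hX mid).1 hmid
  set p := ∫ ω, Real.exp (inner ℝ lam (X 1 ω)) ∂P with hp_def
  set q := ∫ ω, Real.exp (inner ℝ mu (X 1 ω)) ∂P with hq_def
  set r := ∫ ω, Real.exp (inner ℝ mid (X 1 ω)) ∂P with hr_def
  rw [hGp, hGq, hGr, show (2 : EReal) = ((2 : ℝ) : EReal) from rfl, ← EReal.coe_mul,
    ← EReal.coe_add, EReal.coe_lt_coe_iff, ← Real.log_mul hp.ne' hq.ne',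
    show 2 * Real.log r = Real.log (r ^ 2) by rw [Real.log_pow]; norm_num]
  refine Real.log_lt_log (by positivity) ?_
  by_contra! hcon
  have hsq : √q * √p ≤ r := by
    rw [← Real.sqrt_mul hq.le, mul_comm q]
    exact Real.sqrt_le_iff.2 ⟨hr.le, hcon⟩
  -- The expectation of this square is 2pq − 2√(pq)·r, which is at most 0 once √(pq) ≤ r; so the
  -- square vanishes almost surely.
  have hexp : ∀ ω, (√q * Real.exp (inner ℝ lam (X 1 ω) / 2) -
      √p * Real.exp (inner ℝ mu (X 1 ω) / 2)) ^ 2 =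
      q * Real.exp (inner ℝ lam (X 1 ω)) - 2 * (√q * √p) * Real.exp (inner ℝ mid (X 1 ω)) +
        p * Real.exp (inner ℝ mu (X 1 ω)) := fun ω => by
    have e1 : Real.exp (inner ℝ lam (X 1 ω)) = Real.exp (inner ℝ lam (X 1 ω) / 2) ^ 2 := by
      rw [← Real.exp_nat_mul]; congr 1; push_cast; ring
    have e2 : Real.exp (inner ℝ mu (X 1 ω)) = Real.exp (inner ℝ mu (X 1 ω) / 2) ^ 2 := by
      rw [← Real.exp_nat_mul]; congr 1; push_cast; ring
    have e3 : Real.exp (inner ℝ mid (X 1 ω)) =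
        Real.exp (inner ℝ lam (X 1 ω) / 2) * Real.exp (inner ℝ mu (X 1 ω) / 2) := by
      rw [← Real.exp_add, hmid_def, inner_add_left, real_inner_smul_left, real_inner_smul_left]
      congr 1; ring
    rw [e1, e2, e3, sub_sq, mul_pow, mul_pow, Real.sq_sqrt hq.le, Real.sq_sqrt hp.le]
    ring
  have hint : Integrable (fun ω => (√q * Real.exp (inner ℝ lam (X 1 ω) / 2) -
      √p * Real.exp (inner ℝ mu (X 1 ω) / 2)) ^ 2) P := by
    simp_rw [hexp]
    exact ((hip.const_mul _).sub (hir.const_mul _)).add (hiq.const_mul _)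
  have hzero : ∫ ω, (√q * Real.exp (inner ℝ lam (X 1 ω) / 2) -
      √p * Real.exp (inner ℝ mu (X 1 ω) / 2)) ^ 2 ∂P = 0 := by
    refine le_antisymm ?_ (integral_nonneg fun ω => sq_nonneg _)
    simp_rw [hexp]
    have hsub : Integrable (fun ω => q * Real.exp (inner ℝ lam (X 1 ω)) -
        2 * (√q * √p) * Real.exp (inner ℝ mid (X 1 ω))) P :=
      (hip.const_mul _).sub (hir.const_mul _)
    rw [integral_add hsub (hiq.const_mul _), integral_sub (hip.const_mul _) (hir.const_mul _), integral_const_mul, integral_const_mul,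
      integral_const_mul, ← hp_def, ← hq_def, ← hr_def]
    have h1 : (√q * √p) * (√q * √p) = q * p := by
      rw [mul_mul_mul_comm, Real.mul_self_sqrt hq.le, Real.mul_self_sqrt hp.le]
    have h2 : (√q * √p) * (√q * √p) ≤ (√q * √p) * r :=
      mul_le_mul_of_nonneg_left hsq (by positivity)
    linarith
  rw [integral_eq_zero_iff_of_nonneg (fun ω => sq_nonneg _) hint] at hzero
  have hconst : ∀ᵐ ω ∂P, inner ℝ (lam - mu) (X 1 ω) = Real.log p - Real.log q := by
    filter_upwards [hzero] with ω hω
    have h1 : √q * Real.exp (inner ℝ lam (X 1 ω) / 2) =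
        √p * Real.exp (inner ℝ mu (X 1 ω) / 2) := by
      rw [← sub_eq_zero]; exact pow_eq_zero_iff (two_ne_zero) |>.1 hω
    have h2 := congrArg Real.log h1
    rw [Real.log_mul (Real.sqrt_pos.2 hq).ne' (Real.exp_pos _).ne',
      Real.log_mul (Real.sqrt_pos.2 hp).ne' (Real.exp_pos _).ne', Real.log_exp, Real.log_exp,
      Real.log_sqrt hq.le, Real.log_sqrt hp.le] at h2
    rw [inner_sub_left]
    linarith
  obtain ⟨R, hR⟩ := hbdd.subset_closedBall 0
  have hmem : ∀ t : ℝ, t • (lam - mu) ∈ Metric.closedBall (0 : E n) R := fun t => by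
    refine hR ((cumulant_lt_top_iff P hX _).2 ?_)
    refine (integrable_const (Real.exp (t * (Real.log p - Real.log q)))).congr ?_
    filter_upwards [hconst] with ω hω
    rw [real_inner_smul_left, hω]
  have hpos : 0 < ‖lam - mu‖ := norm_pos_iff.2 (sub_ne_zero.2 hne)
  have h1 := hmem ((|R| + 1) / ‖lam - mu‖)
  rw [mem_closedBall_zero_iff, norm_smul, Real.norm_of_nonneg (by positivity),
    div_mul_cancel₀ _ hpos.ne'] at h1
  linarith [le_abs_self R]

theorem isProperCumulant_cumulant [IsProbabilityMeasure P] (hX : Measurable (X 1))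
    (hA2 : AssumptionA2 (cumulant X P)) :
    IsProperCumulant (cumulant X P) where
  lsc := hA2.1
  bounded := hA2.2
  convex := cumulant_convex P hX
  ne_bot := cumulant_ne_bot P hX
  zero := cumulant_zero P
  midpoint_lt := cumulant_midpoint_lt P hX hA2.2

end Cumulant

/-! ### Integrals of extended real functions and Jensen's inequality -/

section Jensen

variable {n : ℕ} {T : ℝ}

theorem comap_volume_real_univ (hT : 0 < T) :
    (volume.comap Subtype.val : Measure (Set.Icc (0 : ℝ) T)).real Set.univ = T := by
  rw [measureReal_def, comap_volume_apply, Subtype.coe_image_univ, Real.volume_Icc, sub_zero,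
    ENNReal.toReal_ofReal hT.le]

theorem eintegral_congr_ae {f g : Set.Icc (0 : ℝ) T → EReal}
    (h : f =ᵐ[volume.comap Subtype.val] g) : eintegral f = eintegral g := by
  have h1 : ∫⁻ t, (f t).toENNReal ∂(volume.comap Subtype.val) =
      ∫⁻ t, (g t).toENNReal ∂(volume.comap Subtype.val) :=
    lintegral_congr_ae (h.mono fun t ht => by simp only [ht])
  have h2 : ∫⁻ t, (-f t).toENNReal ∂(volume.comap Subtype.val) =
      ∫⁻ t, (-g t).toENNReal ∂(volume.comap Subtype.val) :=
    lintegral_congr_ae (h.mono fun t ht => by simp only [ht])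
  rw [eintegral, eintegral, h1, h2]

theorem eintegral_coe {r : Set.Icc (0 : ℝ) T → ℝ} (hr : Integrable r (volume.comap Subtype.val)) :
    eintegral (fun t => (r t : EReal)) =
      ((∫ t, r t ∂(volume.comap Subtype.val) : ℝ) : EReal) := by
  have h1 : ∀ a : ℝ, (a : EReal).toENNReal = ENNReal.ofReal a := fun a => by
    rw [EReal.toENNReal_of_ne_top (EReal.coe_ne_top a), EReal.toReal_coe]
  have h2 : ∫⁻ t, ENNReal.ofReal (-r t) ∂(volume.comap Subtype.val) ≠ ∞ :=
    hr.neg.lintegral_lt_top.ne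
  simp only [eintegral, ← EReal.coe_neg, h1]
  rw [integral_eq_lintegral_pos_part_sub_lintegral_neg_part hr, EReal.coe_sub,
    EReal.coe_ennreal_toReal hr.lintegral_lt_top.ne,
    EReal.coe_ennreal_toReal h2]

theorem lintegral_neg_lt_top {f : Set.Icc (0 : ℝ) T → EReal} {C : ℝ}
    (hf : ∀ t, ((-C : ℝ) : EReal) ≤ f t) :
    ∫⁻ t, (-f t).toENNReal ∂(volume.comap Subtype.val) < ∞ := by
  refine lt_of_le_of_lt (lintegral_mono (g := fun _ => ENNReal.ofReal C) fun t => ?_) ?_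
  · have h : -f t ≤ (C : EReal) := by
      rw [EReal.neg_le, ← EReal.coe_neg]; exact hf t
    calc (-f t).toENNReal ≤ (C : EReal).toENNReal := EReal.toENNReal_le_toENNReal h
      _ = ENNReal.ofReal C := by
        rw [EReal.toENNReal_of_ne_top (EReal.coe_ne_top C), EReal.toReal_coe]
  · rw [lintegral_const]
    exact ENNReal.mul_lt_top ENNReal.ofReal_lt_top (measure_lt_top _ _)

theorem eintegral_ne_bot {f : Set.Icc (0 : ℝ) T → EReal} {C : ℝ}
    (hf : ∀ t, ((-C : ℝ) : EReal) ≤ f t) : eintegral f ≠ ⊥ := by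
  have h2 := (lintegral_neg_lt_top hf).ne
  rw [eintegral, sub_eq_add_neg, Ne, EReal.add_eq_bot_iff, not_or]
  refine ⟨EReal.coe_ennreal_ne_bot _, ?_⟩
  rw [EReal.neg_eq_bot_iff, EReal.coe_ennreal_eq_top_iff]
  exact h2

/-- A measurable function that is bounded below and whose integral is finite is a.e. finite. -/
theorem ae_lt_top_of_eintegral_lt_top {f : Set.Icc (0 : ℝ) T → EReal} (hfm : Measurable f) {C : ℝ}
    (hf : ∀ t, ((-C : ℝ) : EReal) ≤ f t) (hlt : eintegral f < ⊤) :
    (∀ᵐ t ∂(volume.comap Subtype.val), f t < ⊤) ∧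
      Integrable (fun t => (f t).toReal) (volume.comap Subtype.val) ∧
      eintegral f = ((∫ t, (f t).toReal ∂(volume.comap Subtype.val) : ℝ) : EReal) := by
  have hneg := lintegral_neg_lt_top hf
  have hpos : ∫⁻ t, (f t).toENNReal ∂(volume.comap Subtype.val) ≠ ∞ := by
    intro h
    rw [eintegral, h, EReal.coe_ennreal_top, ← EReal.coe_ennreal_toReal hneg.ne,
      EReal.top_sub_coe] at hlt
    exact lt_irrefl _ hlt
  have hae : ∀ᵐ t ∂(volume.comap Subtype.val), f t < ⊤ := by
    filter_upwards [ae_lt_top hfm.ereal_toENNReal hpos] with t ht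
    rw [lt_top_iff_ne_top] at ht ⊢
    intro h
    rw [h] at ht
    exact ht EReal.toENNReal_top
  have hbot : ∀ t, f t ≠ ⊥ := fun t h => by
    have := hf t
    rw [h, le_bot_iff] at this
    exact EReal.coe_ne_bot _ this
  have hint : Integrable (fun t => (f t).toReal) (volume.comap Subtype.val) := by
    refine ⟨hfm.ereal_toReal.aestronglyMeasurable, ?_⟩
    have hle : ∫⁻ t, ‖(f t).toReal‖ₑ ∂(volume.comap Subtype.val) ≤
        ∫⁻ t, ((f t).toENNReal + (-f t).toENNReal) ∂(volume.comap Subtype.val) := by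
      refine lintegral_mono_ae ?_
      filter_upwards [hae] with t ht
      rw [EReal.toENNReal_of_ne_top ht.ne, EReal.toENNReal_of_ne_top (by simpa using hbot t),
        EReal.toReal_neg_eq, ← ofReal_norm, Real.norm_eq_abs]
      rcases le_total 0 (f t).toReal with h | h
      · rw [abs_of_nonneg h]; exact le_self_add
      · rw [abs_of_nonpos h]; exact le_add_self
    refine hle.trans_lt ?_
    rw [lintegral_add_left hfm.ereal_toENNReal]
    exact ENNReal.add_lt_top.2 ⟨hpos.lt_top, hneg⟩
  refine ⟨hae, hint, ?_⟩
  rw [← eintegral_coe hint]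
  refine eintegral_congr_ae ?_
  filter_upwards [hae] with t ht
  exact (EReal.coe_toReal ht.ne (hbot t)).symm

theorem eintegral_const (hT : 0 < T) {a : EReal} (ha : a ≠ ⊥) :
    eintegral (fun _ : Set.Icc (0 : ℝ) T => a) = (T : EReal) * a := by
  induction a with
  | bot => exact absurd rfl ha
  | coe a =>
    rw [eintegral_coe (integrable_const a), integral_const, comap_volume_real_univ hT, smul_eq_mul,
      EReal.coe_mul]
  | top =>
    have h : (volume.comap Subtype.val : Measure (Set.Icc (0 : ℝ) T)) Set.univ ≠ 0 := by
      intro h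
      have := comap_volume_real_univ hT
      rw [measureReal_def, h, ENNReal.toReal_zero] at this
      exact hT.ne this
    rw [EReal.coe_mul_top_of_pos hT, eintegral]
    simp [ENNReal.top_mul h]

variable {G : E n → EReal}

theorem cumulantIntegral_ne_bot (hG : IsProperCumulant G) (θ : M n T) :
    cumulantIntegral G θ ≠ ⊥ := by
  obtain ⟨C, -, hC⟩ := hG.exists_le
  exact eintegral_ne_bot fun t => hC _

/-- Time 0 is Lebesgue-null, so an atom of θ there is invisible to 𝒢. -/
theorem cumulantIntegral_eq_of_tail (hT : 0 < T) (hG : IsProperCumulant G) {θ : M n T} {v : E n}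
    (hθ : ∀ t : Set.Icc (0 : ℝ) T, 0 < (t : ℝ) → θ (Set.Ici t) = v) :
    cumulantIntegral G θ = (T : EReal) * G v := by
  rw [← eintegral_const hT (hG.ne_bot v)]
  refine eintegral_congr_ae ?_
  have h0 : ∀ᵐ t : Set.Icc (0 : ℝ) T ∂(volume.comap Subtype.val), 0 < (t : ℝ) := by
    rw [ae_iff, comap_volume_apply]
    have hsub : Subtype.val '' {t : Set.Icc (0 : ℝ) T | ¬ 0 < (t : ℝ)} ⊆ {0} := by
      rintro _ ⟨t, ht, rfl⟩
      exact le_antisymm (not_lt.1 ht) t.2.1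
    exact measure_mono_null hsub Real.volume_singleton
  filter_upwards [h0] with t ht
  rw [hθ t ht]

/-- **Jensen's inequality** for a lower semicontinuous convex function with values in `(-∞, ∞]`. -/
theorem jensen_toReal (hT : 0 < T) (hG : IsProperCumulant G) {φ : Set.Icc (0 : ℝ) T → E n}
    (hφ : Integrable φ (volume.comap Subtype.val))
    (hfin : ∀ᵐ t ∂(volume.comap Subtype.val), G (φ t) < ⊤)
    (hint : Integrable (fun t => (G (φ t)).toReal) (volume.comap Subtype.val)) :
    G (T⁻¹ • ∫ t, φ t ∂(volume.comap Subtype.val)) ≤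
      ((T⁻¹ * ∫ t, (G (φ t)).toReal ∂(volume.comap Subtype.val) : ℝ) : EReal) := by
  -- The epigraph is closed and convex, so it contains the average of t ↦ (φ(t), G(φ(t))).
  let S : Set (E n × ℝ) := {p | G p.1 ≤ (p.2 : EReal)}
  have hS : IsClosed S :=
    hG.lsc.isClosed_epigraph.preimage
      (continuous_fst.prodMk (continuous_coe_real_ereal.comp continuous_snd))
  have hSc : Convex ℝ S := by
    rw [convex_iff_forall_pos]
    intro p hp q hq a b ha hb hab
    refine (hG.convex p.1 trivial q.1 trivial a b ha hb hab).trans ?_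
    calc (a : EReal) * G p.1 + (b : EReal) * G q.1 ≤ (a : EReal) * p.2 + (b : EReal) * q.2 :=
          add_le_add (mul_le_mul_of_nonneg_left hp (EReal.coe_nonneg.2 ha.le))
            (mul_le_mul_of_nonneg_left hq (EReal.coe_nonneg.2 hb.le))
      _ = (((a • p + b • q).2 : ℝ) : EReal) := by
          simp [EReal.coe_add, EReal.coe_mul]
  have hne : NeZero (volume.comap Subtype.val : Measure (Set.Icc (0 : ℝ) T)) := by
    refine ⟨fun h => ?_⟩
    have := comap_volume_real_univ hT
    rw [h] at this
    simp at this
    exact hT.ne this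
  have h := hSc.average_mem hS (f := fun t => (φ t, (G (φ t)).toReal))
    (μ := (volume.comap Subtype.val : Measure (Set.Icc (0 : ℝ) T)))
    (hfin.mono fun t ht => by
      change G (φ t) ≤ ((G (φ t)).toReal : EReal)
      rw [EReal.coe_toReal ht.ne (hG.ne_bot _)])
    (hφ.prodMk hint)
  rw [average_pair hφ hint, average_eq, average_eq, comap_volume_real_univ hT] at h
  exact h

/-- The mean of `t ↦ θ([t,T])` over `[0,T]`. -/
def tailMean (θ : M n T) : E n := T⁻¹ • ∫ t, θ (Set.Ici t) ∂(volume.comap Subtype.val)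

theorem measurable_cumulant_tail (hG : IsProperCumulant G) (θ : M n T) :
    Measurable fun t => G (θ (Set.Ici t)) :=
  hG.lsc.measurable.comp (stronglyMeasurable_tail θ).measurable

theorem mul_cumulant_tailMean_le (hT : 0 < T) (hG : IsProperCumulant G) (θ : M n T) :
    (T : EReal) * G (tailMean θ) ≤ cumulantIntegral G θ := by
  obtain ⟨C, -, hC⟩ := hG.exists_le
  by_cases hlt : cumulantIntegral G θ < ⊤
  · obtain ⟨hae, hint, heq⟩ := ae_lt_top_of_eintegral_lt_top (measurable_cumulant_tail hG θ)
      (fun t => hC _) hlt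
    have h := jensen_toReal hT hG (integrable_tail θ) hae hint
    rw [cumulantIntegral, heq]
    refine (mul_le_mul_of_nonneg_left h (EReal.coe_nonneg.2 hT.le)).trans (le_of_eq ?_)
    rw [← EReal.coe_mul, mul_inv_cancel_left₀ hT.ne']
  · rw [not_lt_top_iff.1 hlt]; exact le_top

/-- Jensen's inequality for `t ↦ (λ + θ([t,T])) / 2`, with its case of equality. -/
theorem midpoint_tailMean (hT : 0 < T) (hG : IsProperCumulant G) (θ : M n T) {lam : E n}
    (hlam : G lam < ⊤) (hθ : cumulantIntegral G θ < ⊤) :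
    G ((1 / 2 : ℝ) • (lam + tailMean θ)) < ⊤ ∧
      2 * (T * (G ((1 / 2 : ℝ) • (lam + tailMean θ))).toReal) ≤
        T * (G lam).toReal + (cumulantIntegral G θ).toReal ∧
      (T * (G lam).toReal + (cumulantIntegral G θ).toReal ≤
          2 * (T * (G ((1 / 2 : ℝ) • (lam + tailMean θ))).toReal) →
        ∀ᵐ t ∂(volume.comap Subtype.val), θ (Set.Ici t) = lam) := by
  obtain ⟨C, hC0, hC⟩ := hG.exists_le
  obtain ⟨hae, hint, heq⟩ := ae_lt_top_of_eintegral_lt_top (measurable_cumulant_tail hG θ)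
    (fun t => hC _) hθ
  let φ : Set.Icc (0 : ℝ) T → E n := fun t => (1 / 2 : ℝ) • (lam + θ (Set.Ici t))
  have hφ : Integrable φ (volume.comap Subtype.val) :=
    ((integrable_const lam).add (integrable_tail θ)).smul (1 / 2 : ℝ)
  have hφ_meas : Measurable φ :=
    ((stronglyMeasurable_const.add (stronglyMeasurable_tail θ)).const_smul (1 / 2 : ℝ)).measurable
  have hmean : T⁻¹ • ∫ t, φ t ∂(volume.comap Subtype.val) =
      (1 / 2 : ℝ) • (lam + tailMean θ) := by
    have : ∫ t, φ t ∂(volume.comap Subtype.val) =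
        (1 / 2 : ℝ) • (T • lam + ∫ t, θ (Set.Ici t) ∂(volume.comap Subtype.val)) := by
      simp only [φ]
      rw [integral_smul, integral_add (integrable_const _) (integrable_tail θ), integral_const,
        comap_volume_real_univ hT]
    rw [this, smul_comm, smul_add, smul_smul, inv_mul_cancel₀ hT.ne', one_smul, tailMean]
  have hreal : ∀ v, G v < ⊤ → G v = ((G v).toReal : EReal) := fun v hv =>
    (EReal.coe_toReal hv.ne (hG.ne_bot v)).symm
  have hφle : ∀ t, G (θ (Set.Ici t)) < ⊤ → G (φ t) < ⊤ ∧
      (G (φ t)).toReal ≤ ((G lam).toReal + (G (θ (Set.Ici t))).toReal) / 2 := fun t ht => by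
    have h := hG.convex lam trivial (θ (Set.Ici t)) trivial (1 / 2) (1 / 2) (by norm_num)
      (by norm_num) (by norm_num)
    rw [← smul_add, hreal _ hlam, hreal _ ht, ← EReal.coe_mul, ← EReal.coe_mul,
      ← EReal.coe_add] at h
    have hlt := h.trans_lt (EReal.coe_lt_top _)
    refine ⟨hlt, ?_⟩
    have h' : ((G (φ t)).toReal : EReal) ≤ _ := (hreal _ hlt).symm.le.trans h
    rw [EReal.coe_le_coe_iff] at h'
    linarith
  have hφfin : ∀ᵐ t ∂(volume.comap Subtype.val), G (φ t) < ⊤ :=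
    hae.mono fun t ht => (hφle t ht).1
  have hmidint : Integrable (fun t => ((G lam).toReal + (G (θ (Set.Ici t))).toReal) / 2)
      (volume.comap Subtype.val) := ((integrable_const _).add hint).div_const 2
  -- G∘φ is squeezed between −C and the integrable average of the two endpoint values.
  have hφint : Integrable (fun t => (G (φ t)).toReal) (volume.comap Subtype.val) := by
    refine ((integrable_const C).add hmidint.norm).mono'
      (hG.lsc.measurable.comp hφ_meas).ereal_toReal.aestronglyMeasurable ?_
    filter_upwards [hae] with t ht
    obtain ⟨h1, h2⟩ := hφle t ht
    have h3 := hC (φ t)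
    rw [hreal _ h1, EReal.coe_le_coe_iff] at h3
    rw [Real.norm_eq_abs, abs_le]
    have h4 := le_abs_self (((G lam).toReal + (G (θ (Set.Ici t))).toReal) / 2)
    have h5 := abs_nonneg (((G lam).toReal + (G (θ (Set.Ici t))).toReal) / 2)
    simp only [Pi.add_apply, Real.norm_eq_abs]
    constructor <;> linarith
  have hJ := jensen_toReal hT hG hφ hφfin hφint
  rw [hmean] at hJ
  have hmidlt := hJ.trans_lt (EReal.coe_lt_top _)
  rw [hreal _ hmidlt, EReal.coe_le_coe_iff, ← div_eq_inv_mul, le_div_iff₀ hT, mul_comm] at hJ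
  have hmono : ∫ t, (G (φ t)).toReal ∂(volume.comap Subtype.val) ≤
      ∫ t, ((G lam).toReal + (G (θ (Set.Ici t))).toReal) / 2 ∂(volume.comap Subtype.val) :=
    integral_mono_ae hφint hmidint (hae.mono fun t ht => (hφle t ht).2)
  have hsum : ∫ t, ((G lam).toReal + (G (θ (Set.Ici t))).toReal) / 2
      ∂(volume.comap Subtype.val) =
      (T * (G lam).toReal + (cumulantIntegral G θ).toReal) / 2 := by
    rw [integral_div, integral_add (integrable_const _) hint, integral_const,
      comap_volume_real_univ hT, smul_eq_mul, cumulantIntegral, heq, EReal.toReal_coe]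
  rw [hsum] at hmono
  refine ⟨hmidlt, by linarith, fun hge => ?_⟩
  -- Equality overall makes both Jensen and the integrated midpoint inequality equalities; the
  -- latter is then an equality for a.e. t, and strict convexity identifies θ([t,T]) with lam.
  have heqint : ∫ t, (G (φ t)).toReal ∂(volume.comap Subtype.val) =
      ∫ t, ((G lam).toReal + (G (θ (Set.Ici t))).toReal) / 2 ∂(volume.comap Subtype.val) := by
    rw [hsum]; linarith
  have haeeq := (integral_eq_iff_of_ae_le hφint hmidint
    (hae.mono fun t ht => (hφle t ht).2)).1 heqint
  filter_upwards [hae, haeeq] with t ht htt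
  by_contra hne
  have hlt := hG.midpoint_lt lam (θ (Set.Ici t)) (Ne.symm hne) hlam ht
  obtain ⟨h1, -⟩ := hφle t ht
  rw [← smul_add, hreal _ hlam, hreal _ ht,
    show G ((1 / 2 : ℝ) • (lam + θ (Set.Ici t))) = ((G (φ t)).toReal : EReal) from hreal _ h1,
    show (2 : EReal) = ((2 : ℝ) : EReal) from rfl, ← EReal.coe_mul, ← EReal.coe_add,
    EReal.coe_lt_coe_iff] at hlt
  linarith

end Jensen

/-! ### The finite-dimensional problem -/

section Euro

variable {n : ℕ} {T : ℝ} {G h : E n → EReal}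

theorem conjugate_ne_bot (h_proper : ∃ v, h v ≠ ⊥) (lam : E n) : conjugate h lam ≠ ⊥ := by
  obtain ⟨v, hv⟩ := h_proper
  intro hbot
  have h1 : h v - ((inner ℝ v lam : ℝ) : EReal) ≤ ⊥ :=
    (le_iSup (fun v => h v - ((inner ℝ v lam : ℝ) : EReal)) v).trans hbot.le
  rw [le_bot_iff, sub_eq_add_neg, EReal.add_eq_bot_iff] at h1
  rcases h1 with h1 | h1
  · exact hv h1
  · rw [← EReal.coe_neg] at h1
    exact EReal.coe_ne_bot _ h1

/-- A supremum of affine functions; points with h v = ⊥ contribute ⊥ and drop out. The same reason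
gives `conjugate_lsc`. -/
theorem conjugate_convex (h_ne_top : ∀ v, h v ≠ ⊤) : EConvexOn Set.univ (conjugate h) := by
  intro x _ y _ a b ha hb hab
  refine iSup_le fun v => ?_
  by_cases hv : h v = ⊥
  · rw [hv, EReal.bot_sub]; exact bot_le
  have hx : h v - ((inner ℝ v x : ℝ) : EReal) ≤ conjugate h x :=
    le_iSup (fun v => h v - ((inner ℝ v x : ℝ) : EReal)) v
  have hy : h v - ((inner ℝ v y : ℝ) : EReal) ≤ conjugate h y :=
    le_iSup (fun v => h v - ((inner ℝ v y : ℝ) : EReal)) v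
  refine le_trans (le_of_eq ?_) (add_le_add
    (mul_le_mul_of_nonneg_left hx (EReal.coe_nonneg.2 ha.le))
    (mul_le_mul_of_nonneg_left hy (EReal.coe_nonneg.2 hb.le)))
  rw [← EReal.coe_toReal (h_ne_top v) hv]
  norm_cast
  rw [inner_add_right, real_inner_smul_right, real_inner_smul_right]
  linear_combination (h v).toReal * (-hab)

theorem conjugate_lsc (h_ne_top : ∀ v, h v ≠ ⊤) : LowerSemicontinuous (conjugate h) := by
  refine lowerSemicontinuous_iSup fun v => ?_
  by_cases hv : h v = ⊥
  · simp only [hv, EReal.bot_sub]; exact lowerSemicontinuous_const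
  · rw [← EReal.coe_toReal (h_ne_top v) hv]
    refine Continuous.lowerSemicontinuous ?_
    simp only [← EReal.coe_sub]
    exact continuous_coe_real_ereal.comp (continuous_const.sub (continuous_const.inner continuous_id))

theorem coe_mul_ne_bot (hT : 0 < T) {a : EReal} (ha : a ≠ ⊥) : (T : EReal) * a ≠ ⊥ := by
  induction a with
  | bot => exact absurd rfl ha
  | coe a => rw [← EReal.coe_mul]; exact EReal.coe_ne_bot _
  | top => rw [EReal.coe_mul_top_of_pos hT]; exact top_ne_bot

theorem coe_mul_lsc (hT : 0 < T) (hG : LowerSemicontinuous G) :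
    LowerSemicontinuous fun lam => (T : EReal) * G lam := by
  have hcont : Continuous fun a : EReal => (T : EReal) * a := by
    rw [continuous_iff_continuousAt]
    intro a
    have h0 : (T : EReal) ≠ 0 := by exact_mod_cast hT.ne'
    exact (EReal.continuousAt_mul (p := ((T : EReal), a)) (.inl h0) (.inl h0)
      (.inl (EReal.coe_ne_bot _)) (.inl (EReal.coe_ne_top _))).comp
      (continuousAt_const.prodMk continuousAt_id)
  exact hcont.comp_lowerSemicontinuous hG fun a b hab =>
    mul_le_mul_of_nonneg_left hab (EReal.coe_nonneg.2 hT.le)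

/-- Neither summand can be ⊥, so a finite sum has finite summands. This is the passage to real
arithmetic. -/
theorem euroObjective_eq_coe (hT : 0 < T) (hG : IsProperCumulant G) (h_proper : ∃ v, h v ≠ ⊥)
    {lam : E n} (hlt : euroObjective T G h lam < ⊤) :
    conjugate h lam < ⊤ ∧ G lam < ⊤ ∧ euroObjective T G h lam =
      (((conjugate h lam).toReal + T * (G lam).toReal : ℝ) : EReal) := by
  have h1 := (EReal.add_ne_top_iff_ne_top₂ (conjugate_ne_bot h_proper lam)
    (coe_mul_ne_bot hT (hG.ne_bot lam))).1 hlt.ne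
  have h2 : G lam ≠ ⊤ := fun h => by
    rw [h, EReal.coe_mul_top_of_pos hT] at h1; exact h1.2 rfl
  refine ⟨h1.1.lt_top, h2.lt_top, ?_⟩
  rw [EReal.coe_add, EReal.coe_mul, EReal.coe_toReal h1.1 (conjugate_ne_bot h_proper lam),
    EReal.coe_toReal h2 (hG.ne_bot lam)]
  rfl

theorem euroObjective_convex (hT : 0 < T) (hG : IsProperCumulant G)
    (h_ne_top : ∀ v, h v ≠ ⊤) : EConvexOn Set.univ (euroObjective T G h) := by
  intro x hx y hy a b ha hb hab
  have ha' := EReal.coe_nonneg.2 ha.le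
  have hb' := EReal.coe_nonneg.2 hb.le
  have hT' := EReal.coe_nonneg.2 hT.le
  calc euroObjective T G h (a • x + b • y)
      ≤ ((a : EReal) * conjugate h x + (b : EReal) * conjugate h y) +
        (T : EReal) * ((a : EReal) * G x + (b : EReal) * G y) :=
        add_le_add (conjugate_convex h_ne_top x hx y hy a b ha hb hab)
          (mul_le_mul_of_nonneg_left (hG.convex x hx y hy a b ha hb hab) hT')
    _ = (a : EReal) * euroObjective T G h x + (b : EReal) * euroObjective T G h y := by
        rw [euroObjective, euroObjective,
          EReal.left_distrib_of_nonneg_of_ne_top ha' (EReal.coe_ne_top _),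
          EReal.left_distrib_of_nonneg_of_ne_top hb' (EReal.coe_ne_top _),
          EReal.left_distrib_of_nonneg_of_ne_top hT' (EReal.coe_ne_top _),
          ← mul_assoc, ← mul_assoc, ← mul_assoc, ← mul_assoc, mul_comm (T : EReal) a,
          mul_comm (T : EReal) b, add_add_add_comm]

theorem exists_isMinOn_euroObjective (hT : 0 < T) (hG : IsProperCumulant G)
    (h_ne_top : ∀ v, h v ≠ ⊤) (h_proper : ∃ v, h v ≠ ⊥) :
    ∃ v, IsMinOn (euroObjective T G h) Set.univ v := by
  have hlsc : LowerSemicontinuous (euroObjective T G h) :=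
    (conjugate_lsc h_ne_top).add' (coe_mul_lsc hT hG.lsc) fun lam =>
      EReal.continuousAt_add (.inr (coe_mul_ne_bot hT (hG.ne_bot lam)))
        (.inl (conjugate_ne_bot h_proper lam))
  obtain ⟨R, hR⟩ := hG.bounded.subset_closedBall 0
  have hne : (Metric.closedBall (0 : E n) R).Nonempty :=
    ⟨0, hR (show G 0 < ⊤ by rw [hG.zero]; exact EReal.zero_lt_top)⟩
  obtain ⟨a, -, ha⟩ := (hlsc.lowerSemicontinuousOn _).exists_isMinOn hne
    (isCompact_closedBall (0 : E n) R)
  refine ⟨a, fun lam _ => ?_⟩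
  by_cases hlt : euroObjective T G h lam < ⊤
  · exact ha (hR (euroObjective_eq_coe hT hG h_proper hlt).2.1)
  · change _ ≤ euroObjective T G h lam
    rw [not_lt_top_iff.1 hlt]; exact le_top

/-- At the midpoint of two distinct minimizers the G-term drops strictly, while the conjugate does
not exceed the average. -/
theorem isMinOn_euroObjective_unique (hT : 0 < T) (hG : IsProperCumulant G)
    (h_ne_top : ∀ v, h v ≠ ⊤) (h_proper : ∃ v, h v ≠ ⊥)
    (hfeas : ∃ v, euroObjective T G h v < ⊤) {v w : E n}
    (hv : IsMinOn (euroObjective T G h) Set.univ v)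
    (hw : IsMinOn (euroObjective T G h) Set.univ w) : v = w := by
  by_contra hne
  obtain ⟨u, hu⟩ := hfeas
  obtain ⟨hcv, hGv, hfv⟩ := euroObjective_eq_coe hT hG h_proper ((hv (Set.mem_univ u)).trans_lt hu)
  obtain ⟨hcw, hGw, hfw⟩ := euroObjective_eq_coe hT hG h_proper ((hw (Set.mem_univ u)).trans_lt hu)
  set mid := (1 / 2 : ℝ) • v + (1 / 2 : ℝ) • w with hmid
  have hconv := euroObjective_convex hT hG h_ne_top v trivial w trivial (1 / 2) (1 / 2)
    (by norm_num) (by norm_num) (by norm_num)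
  rw [hfv, hfw, ← EReal.coe_mul, ← EReal.coe_mul, ← EReal.coe_add] at hconv
  obtain ⟨hcm, hGm, hfm⟩ := euroObjective_eq_coe hT hG h_proper
    (hconv.trans_lt (EReal.coe_lt_top _))
  rw [← hmid] at hcm hGm hfm
  have hreal : ∀ u, G u < ⊤ → G u = ((G u).toReal : EReal) := fun v hv =>
    (EReal.coe_toReal hv.ne (hG.ne_bot v)).symm
  have hrealc : ∀ u, conjugate h u < ⊤ → conjugate h u = ((conjugate h u).toReal : EReal) :=
    fun v hv => (EReal.coe_toReal hv.ne (conjugate_ne_bot h_proper v)).symm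
  have h1 := hG.midpoint_lt v w hne hGv hGw
  rw [← hmid, hreal _ hGv, hreal _ hGw, hreal _ hGm, show (2 : EReal) = ((2 : ℝ) : EReal) from rfl,
    ← EReal.coe_mul, ← EReal.coe_add, EReal.coe_lt_coe_iff] at h1
  have h2 := conjugate_convex h_ne_top v trivial w trivial (1 / 2) (1 / 2)
    (by norm_num) (by norm_num) (by norm_num)
  rw [← hmid, hrealc _ hcv, hrealc _ hcw, hrealc _ hcm, ← EReal.coe_mul, ← EReal.coe_mul,
    ← EReal.coe_add, EReal.coe_le_coe_iff] at h2
  have h3 : euroObjective T G h v ≤ euroObjective T G h mid := hv (Set.mem_univ _)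
  have h4 : euroObjective T G h w ≤ euroObjective T G h mid := hw (Set.mem_univ _)
  rw [hfv, hfm, EReal.coe_le_coe_iff] at h3
  rw [hfw, hfm, EReal.coe_le_coe_iff] at h4
  have h5 := mul_lt_mul_of_pos_left h1 hT
  linarith

end Euro

/-! ### The dual functional -/

section Dual

variable {n : ℕ} {T : ℝ} {G h : E n → EReal}

theorem pathConjugate_dirac (hT : 0 < T) (v : E n) :
    pathConjugate (europeanLogPayoff hT h) (VectorMeasure.dirac (finalTime hT) v) =
      conjugate h v := by
  refine le_antisymm (iSup₂_le fun x _ => ?_) (iSup_le fun w => ?_)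
  · rw [pairing_dirac]
    exact le_iSup (fun w => h w - ((inner ℝ w v : ℝ) : EReal)) (x (finalTime hT))
  · have h1 := le_iSup₂ (f := fun x (_ : x ∈ Vr n T) => europeanLogPayoff hT h x -
      ((pairing x (VectorMeasure.dirac (finalTime hT) v) : ℝ) : EReal)) _ (const_mem_Vr hT w)
    rwa [pairing_dirac] at h1

/-- An excursion on [s,T) in the direction −θ([s,T)) is free for the payoff and lowers the pairing
without bound. -/
theorem pathConjugate_eq_top (hT : 0 < T) (h_ne_top : ∀ v, h v ≠ ⊤) (h_proper : ∃ v, h v ≠ ⊥)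
    {θ : M n T} {s : Set.Icc (0 : ℝ) T} (hs : θ (Set.Ico s (finalTime hT)) ≠ 0) :
    pathConjugate (europeanLogPayoff hT h) θ = ⊤ := by
  obtain ⟨w, hw⟩ := h_proper
  set a := θ (Set.Ico s (finalTime hT)) with ha
  rw [EReal.eq_top_iff_forall_lt]
  intro r
  have hpos : 0 < ‖a‖ ^ 2 := by positivity
  -- Solved so that the test path gives exactly r + 1.
  let c : ℝ := (r + 1 - (h w).toReal + inner ℝ w (θ Set.univ)) / ‖a‖ ^ 2
  have h1 := le_iSup₂ (f := fun x (_ : x ∈ Vr n T) =>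
    europeanLogPayoff hT h x - ((pairing x θ : ℝ) : EReal)) _
    (indicator_Ico_mem_Vr hT s w (-c • a))
  refine lt_of_lt_of_le ?_ h1
  have h2 : europeanLogPayoff hT h (fun t => w +
      (Set.Ico s (finalTime hT)).indicator (fun _ => (1 : ℝ)) t • (-c • a)) = h w := by
    simp [europeanLogPayoff]
  rw [h2, pairing_const_add_indicator θ w _ measurableSet_Ico, ← ha, real_inner_smul_left,
    real_inner_self_eq_norm_sq, ← EReal.coe_toReal (h_ne_top w) hw, ← EReal.coe_sub,
    EReal.coe_lt_coe_iff]
  have h3 : c * ‖a‖ ^ 2 = r + 1 - (h w).toReal + inner ℝ w (θ Set.univ) :=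
    div_mul_cancel₀ _ hpos.ne'
  linarith

theorem eq_dirac_of_Ico_eq_zero (hT : 0 < T) {θ : M n T}
    (hθ : ∀ s, θ (Set.Ico s (finalTime hT)) = 0) :
    θ = VectorMeasure.dirac (finalTime hT) (θ {finalTime hT}) := by
  refine ext_of_tail hT fun t => ?_
  rw [dirac_tail]
  have hle : t ≤ finalTime hT := t.2.2
  have : Set.Ici t = Set.Ico t (finalTime hT) ∪ {finalTime hT} := by
    rw [Set.Ico_union_right hle]
    ext s
    exact ⟨fun hs => ⟨hs, s.2.2⟩, fun hs => hs.1⟩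
  rw [this, VectorMeasure.of_union (by simp) measurableSet_Ico (measurableSet_singleton _), hθ,
    zero_add]

theorem dualFunctional_dirac (hT : 0 < T) (hG : IsProperCumulant G) (v : E n) :
    dualFunctional G (europeanLogPayoff hT h) (VectorMeasure.dirac (finalTime hT) v) =
      euroObjective T G h v := by
  rw [dualFunctional, pathConjugate_dirac,
    cumulantIntegral_eq_of_tail hT hG fun t _ => dirac_tail hT v t]
  rfl

theorem exists_eq_dirac_of_dualFunctional_lt_top (hT : 0 < T) (hG : IsProperCumulant G)
    (h_ne_top : ∀ v, h v ≠ ⊤) (h_proper : ∃ v, h v ≠ ⊥) {θ : M n T}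
    (hθ : dualFunctional G (europeanLogPayoff hT h) θ < ⊤) :
    ∃ v, θ = VectorMeasure.dirac (finalTime hT) v := by
  refine ⟨_, eq_dirac_of_Ico_eq_zero hT fun s => ?_⟩
  by_contra hs
  rw [dualFunctional, pathConjugate_eq_top hT h_ne_top h_proper hs,
    EReal.top_add_of_ne_bot (cumulantIntegral_ne_bot hG θ)] at hθ
  exact lt_irrefl _ hθ

theorem iInf_dualFunctional (hT : 0 < T) (hG : IsProperCumulant G)
    (h_ne_top : ∀ v, h v ≠ ⊤) (h_proper : ∃ v, h v ≠ ⊥) :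
    ⨅ θ, dualFunctional G (europeanLogPayoff hT h) θ = ⨅ v, euroObjective T G h v := by
  refine le_antisymm (le_iInf fun v => ?_) (le_iInf fun θ => ?_)
  · rw [← dualFunctional_dirac hT hG]
    exact iInf_le _ _
  · by_cases hθ : dualFunctional G (europeanLogPayoff hT h) θ < ⊤
    · obtain ⟨v, rfl⟩ := exists_eq_dirac_of_dualFunctional_lt_top hT hG h_ne_top h_proper hθ
      rw [dualFunctional_dirac hT hG]
      exact iInf_le _ _
    · rw [not_lt_top_iff.1 hθ]; exact le_top

end Dual

/-! ### The proxy of the variance -/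

section Proxy

variable {n : ℕ} {T : ℝ} {G h : E n → EReal}

theorem coe_toReal_cumulant (hG : IsProperCumulant G) {lam : E n} (h : G lam < ⊤) :
    G lam = ((G lam).toReal : EReal) :=
  (EReal.coe_toReal h.ne (hG.ne_bot lam)).symm

/-- The proxy at a measure that equals `v δ_T` on `(0,T]` is at most twice the objective at `v`. -/
theorem varianceProxy_le_of_tail (hT : 0 < T) (hG : IsProperCumulant G)
    (h_ne_top : ∀ v, h v ≠ ⊤) (h_proper : ∃ v, h v ≠ ⊥) {θ : M n T} {v : E n}
    (hθ : ∀ t : Set.Icc (0 : ℝ) T, 0 < (t : ℝ) → θ (Set.Ici t) = v) :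
    varianceProxy G (europeanLogPayoff hT h) θ ≤ 2 * euroObjective T G h v := by
  by_cases hlt : euroObjective T G h v < ⊤
  swap
  · rw [not_lt_top_iff.1 hlt, show (2 : EReal) = ((2 : ℝ) : EReal) from rfl,
      EReal.coe_mul_top_of_pos two_pos]
    exact le_top
  obtain ⟨hc, hGv, hf⟩ := euroObjective_eq_coe hT hG h_proper hlt
  refine iSup₂_le fun x hx => ?_
  by_cases hxbot : h (x (finalTime hT)) = ⊥
  · have h0 : europeanLogPayoff hT h x = ⊥ := hxbot
    rw [h0, show (2 : EReal) = ((2 : ℝ) : EReal) from rfl, EReal.coe_mul_bot_of_pos two_pos]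
    simp
  set δ : M n T := VectorMeasure.dirac (finalTime hT) v with hδ
  -- The reflection 2δ − θ has the tails of δ on (0,T], hence the same 𝒢. Used in J̄(x), it cancels
  -- the pairing with θ and leaves 2⟨x_T, v⟩.
  let μ : M n T := δ - (θ - δ)
  have hμ : ∀ t : Set.Icc (0 : ℝ) T, 0 < (t : ℝ) → μ (Set.Ici t) = v := fun t ht => by
    simp only [μ, sub_apply, hθ t ht, hδ, dirac_tail, sub_self, sub_zero]
  have hpair : pairing x μ = 2 * inner ℝ (x (finalTime hT)) v - pairing x θ := by
    rw [pairing_sub_measure hT hx, pairing_sub_measure hT hx, hδ, pairing_dirac]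
    ring
  have hK : ∀ η : M n T, (∀ t : Set.Icc (0 : ℝ) T, 0 < (t : ℝ) → η (Set.Ici t) = v) →
      cumulantIntegral G η = ((T * (G v).toReal : ℝ) : EReal) := fun η hη => by
    rw [cumulantIntegral_eq_of_tail hT hG hη, EReal.coe_mul, ← coe_toReal_cumulant hG hGv]
  have hrate : ((2 * inner ℝ (x (finalTime hT)) v - pairing x θ - T * (G v).toReal : ℝ) : EReal) ≤
      rate G x := by
    rw [rate, if_pos hx]
    refine le_trans (le_of_eq ?_)
      (le_iSup (fun μ : M n T => ((pairing x μ : ℝ) : EReal) - cumulantIntegral G μ) μ)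
    rw [hK μ hμ, hpair, EReal.coe_sub]
  have hconj : h (x (finalTime hT)) - ((inner ℝ (x (finalTime hT)) v : ℝ) : EReal) ≤
      conjugate h v :=
    le_iSup (fun w => h w - ((inner ℝ w v : ℝ) : EReal)) (x (finalTime hT))
  have hH : europeanLogPayoff hT h x = ((h (x (finalTime hT))).toReal : EReal) :=
    (EReal.coe_toReal (h_ne_top _) hxbot).symm
  rw [← EReal.coe_toReal (h_ne_top _) hxbot,
    ← EReal.coe_toReal hc.ne (conjugate_ne_bot h_proper v), ← EReal.coe_sub,
    EReal.coe_le_coe_iff] at hconj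
  refine (EReal.sub_le_sub le_rfl hrate).trans ?_
  rw [hH, hK θ hθ, hf, show (2 : EReal) = ((2 : ℝ) : EReal) from rfl, ← EReal.coe_mul,
    ← EReal.coe_sub, ← EReal.coe_add, ← EReal.coe_sub, ← EReal.coe_mul, EReal.coe_le_coe_iff]
  linarith

/-- Minimax duality between `h` and `T G`: if `s` bounds `2 h(v) - ⟨v, θ⟩ - (T G)^*(v)`, then the
dual problem has a feasible point with value at most `s`. -/
theorem exists_dual_point (hT : 0 < T) (hG : IsProperCumulant G) (h_ne_top : ∀ v, h v ≠ ⊤)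
    (h_proper : ∃ v, h v ≠ ⊥) (h_concave : EConcaveOn Set.univ h) (h_usc : UpperSemicontinuous h)
    (θ : E n) (s : ℝ)
    (hs : ∀ (v : E n) (ρ : ℝ), h v ≠ ⊥ →
      (∀ lam, G lam < ⊤ → inner ℝ v lam - T * (G lam).toReal ≤ ρ) →
      2 * (h v).toReal - inner ℝ v θ - ρ ≤ s) :
    ∃ lam, G lam < ⊤ ∧ ∀ v, h v ≠ ⊥ →
      2 * (h v).toReal - inner ℝ v (θ + lam) + T * (G lam).toReal ≤ s := by
  obtain ⟨R, hR⟩ := hG.bounded.subset_closedBall 0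
  let K : Set (E n) := Metric.closedBall 0 R
  -- On Y the payoff is real, so the infinite values of Φ come from G alone. Compactness for Sion's
  -- theorem is on the side of λ.
  let Y : Set (E n) := {v | h v ≠ ⊥}
  let ψ : E n → E n → ℝ := fun lam v => 2 * (h v).toReal - inner ℝ v (θ + lam)
  let Φ : E n → E n → EReal := fun lam v => (T : EReal) * G lam + (ψ lam v : EReal)
  have hΦ : ∀ lam v, G lam < ⊤ →
      Φ lam v = ((T * (G lam).toReal + ψ lam v : ℝ) : EReal) := fun lam v hl => by
    simp only [Φ]
    rw [coe_toReal_cumulant hG hl, EReal.coe_add, EReal.coe_mul, EReal.toReal_coe]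
  have hΦtop : ∀ lam v, ¬ G lam < ⊤ → Φ lam v = ⊤ := fun lam v hl => by
    simp only [Φ]
    rw [not_lt_top_iff.1 hl, EReal.coe_mul_top_of_pos hT, EReal.top_add_coe]
  have hreal : ∀ v ∈ Y, h v = ((h v).toReal : EReal) := fun v hv =>
    (EReal.coe_toReal (h_ne_top v) hv).symm
  have hconc : ∀ v ∈ Y, ∀ w ∈ Y, ∀ a b : ℝ, 0 < a → 0 < b → a + b = 1 →
      a • v + b • w ∈ Y ∧
        a * (h v).toReal + b * (h w).toReal ≤ (h (a • v + b • w)).toReal := by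
    intro v hv w hw a b ha hb hab
    have h1 := h_concave v trivial w trivial a b ha hb hab
    rw [hreal v hv, hreal w hw, ← EReal.coe_mul, ← EReal.coe_mul, ← EReal.coe_add] at h1
    have h2 : a • v + b • w ∈ Y := fun hbot => by
      rw [hbot, le_bot_iff] at h1
      exact EReal.coe_ne_bot _ h1
    rw [hreal _ h2, EReal.coe_le_coe_iff] at h1
    exact ⟨h2, h1⟩
  have neK : K.Nonempty := ⟨0, hR (show G 0 < ⊤ by rw [hG.zero]; exact EReal.zero_lt_top)⟩
  have kK : IsCompact K := isCompact_closedBall 0 R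
  have cK : Convex ℝ K := convex_closedBall 0 R
  have cY : Convex ℝ Y := convex_iff_forall_pos.2 fun v hv w hw a b ha hb hab =>
    (hconc v hv w hw a b ha hb hab).1
  have hlsc : ∀ v ∈ Y, LowerSemicontinuousOn (fun lam => Φ lam v) K := fun v _ => by
    refine LowerSemicontinuous.lowerSemicontinuousOn ?_ K
    refine (coe_mul_lsc hT hG.lsc).add' (Continuous.lowerSemicontinuous ?_) fun lam =>
      EReal.continuousAt_add (.inr (EReal.coe_ne_bot _)) (.inr (EReal.coe_ne_top _))
    exact continuous_coe_real_ereal.comp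
      (continuous_const.sub (continuous_const.inner (continuous_const.add continuous_id)))
  have hqcvx : ∀ v ∈ Y, QuasiconvexOn ℝ K fun lam => Φ lam v := by
    intro v _ r
    rw [convex_iff_forall_pos]
    rintro x ⟨hxK, hx⟩ y ⟨hyK, hy⟩ a b ha hb hab
    refine ⟨cK hxK hyK ha.le hb.le hab, ?_⟩
    have ha' := EReal.coe_nonneg.2 ha.le
    have hb' := EReal.coe_nonneg.2 hb.le
    have hT' := EReal.coe_nonneg.2 hT.le
    have hψ : ψ (a • x + b • y) v = a * ψ x v + b * ψ y v := by
      simp only [ψ, inner_add_right, real_inner_smul_right]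
      linear_combination (2 * (h v).toReal - inner ℝ v θ) * (-hab)
    calc Φ (a • x + b • y) v
        ≤ (T : EReal) * ((a : EReal) * G x + (b : EReal) * G y) +
          ((a : EReal) * ψ x v + (b : EReal) * ψ y v) := by
          refine add_le_add (mul_le_mul_of_nonneg_left
            (hG.convex x trivial y trivial a b ha hb hab) hT') (le_of_eq ?_)
          rw [hψ, EReal.coe_add, EReal.coe_mul, EReal.coe_mul]
      _ = (a : EReal) * Φ x v + (b : EReal) * Φ y v := by
          simp only [Φ]
          rw [EReal.left_distrib_of_nonneg_of_ne_top ha' (EReal.coe_ne_top _),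
            EReal.left_distrib_of_nonneg_of_ne_top hb' (EReal.coe_ne_top _),
            EReal.left_distrib_of_nonneg_of_ne_top hT' (EReal.coe_ne_top _),
            ← mul_assoc, ← mul_assoc, ← mul_assoc, ← mul_assoc, mul_comm (T : EReal) a,
            mul_comm (T : EReal) b, add_add_add_comm]
      _ ≤ (a : EReal) * r + (b : EReal) * r :=
          add_le_add (mul_le_mul_of_nonneg_left hx ha') (mul_le_mul_of_nonneg_left hy hb')
      _ = r := by
          rw [← EReal.right_distrib_of_nonneg ha' hb', ← EReal.coe_add, hab, EReal.coe_one,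
            one_mul]
  have husc : ∀ lam ∈ K, UpperSemicontinuousOn (fun v => Φ lam v) Y := by
    intro lam _
    by_cases hl : G lam < ⊤
    · simp only [hΦ lam _ hl]
      have h1 : UpperSemicontinuousOn (fun v => (h v).toReal) Y := by
        intro v hv c hc
        have h2 : h v < (c : EReal) := by
          rw [hreal v hv]; exact EReal.coe_lt_coe_iff.2 hc
        filter_upwards [(h_usc v _ h2).filter_mono nhdsWithin_le_nhds, self_mem_nhdsWithin]
          with w hw hwY
        rwa [hreal w hwY, EReal.coe_lt_coe_iff] at hw
      have h2 : UpperSemicontinuousOn (fun v => T * (G lam).toReal + ψ lam v) Y := by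
        have : (fun v => T * (G lam).toReal + ψ lam v) = fun v =>
            ((h v).toReal + (h v).toReal) + (T * (G lam).toReal - inner ℝ v (θ + lam)) := by
          ext1 v; simp only [ψ]; ring
        rw [this]
        have h3 : Continuous fun v => T * (G lam).toReal - inner ℝ v (θ + lam) :=
          continuous_const.sub (continuous_id.inner continuous_const)
        exact (h1.add h1).add (h3.upperSemicontinuous.upperSemicontinuousOn Y)
      exact continuous_coe_real_ereal.comp_upperSemicontinuousOn h2
        fun a b hab => EReal.coe_le_coe_iff.2 hab
    · simp only [hΦtop lam _ hl]
      exact upperSemicontinuousOn_const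
  have hqccv : ∀ lam ∈ K, QuasiconcaveOn ℝ Y fun v => Φ lam v := by
    intro lam _ r
    rw [convex_iff_forall_pos]
    rintro v ⟨hvY, hv⟩ w ⟨hwY, hw⟩ a b ha hb hab
    obtain ⟨hmem, hle⟩ := hconc v hvY w hwY a b ha hb hab
    refine ⟨hmem, ?_⟩
    by_cases hl : G lam < ⊤
    · simp only [hΦ lam _ hl] at hv hw ⊢
      have hψ : a * ψ lam v + b * ψ lam w ≤ ψ lam (a • v + b • w) := by
        simp only [ψ]
        rw [inner_add_left, real_inner_smul_left, real_inner_smul_left]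
        linarith
      have hsum : ∀ c : ℝ, a * c + b * c = c := fun c => by rw [← add_mul, hab, one_mul]
      rcases le_total (ψ lam v) (ψ lam w) with hvw | hvw
      · refine hv.trans (EReal.coe_le_coe_iff.2 ?_)
        have := mul_le_mul_of_nonneg_left hvw hb.le
        linarith [hsum (ψ lam v)]
      · refine hw.trans (EReal.coe_le_coe_iff.2 ?_)
        have := mul_le_mul_of_nonneg_left hvw ha.le
        linarith [hsum (ψ lam w)]
    · simp only [hΦtop lam _ hl]
      exact le_top
  have hminimax := Sion.minimax' neK cK kK hlsc hqcvx cY husc hqccv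
  -- If the inner infimum exceeded s, a real r in between would make 2h(v) − ⟨v,θ⟩ − r an admissible
  -- ρ, and the hypothesis would give r ≤ s.
  have hsup : ⨆ v ∈ Y, ⨅ lam ∈ K, Φ lam v ≤ (s : EReal) := by
    refine iSup₂_le fun v hv => ?_
    by_contra! hcon
    obtain ⟨r, hsr, hr⟩ := EReal.lt_iff_exists_real_btwn.1 hcon
    have := hs v (2 * (h v).toReal - inner ℝ v θ - r) hv fun lam hl => by
      have h1 : (r : EReal) ≤ Φ lam v := hr.le.trans (iInf₂_le lam (hR hl))
      rw [hΦ lam v hl, EReal.coe_le_coe_iff] at h1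
      simp only [ψ, inner_add_right] at h1
      linarith
    rw [EReal.coe_lt_coe_iff] at hsr
    linarith
  -- Minimax only equates values; compactness and semicontinuity of the supremum produce an actual
  -- λ.
  have hlscS : LowerSemicontinuousOn (fun lam => ⨆ v ∈ Y, Φ lam v) K := fun x hx =>
    lowerSemicontinuousWithinAt_iSup fun v => lowerSemicontinuousWithinAt_iSup fun hv =>
      hlsc v hv x hx
  obtain ⟨lam, hlK, hlmin⟩ := hlscS.exists_isMinOn neK kK
  have hle : ⨆ v ∈ Y, Φ lam v ≤ (s : EReal) := by
    refine le_trans ?_ (hminimax.le.trans hsup)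
    exact le_iInf₂ fun x hx => hlmin hx
  have hall : ∀ v ∈ Y, Φ lam v ≤ (s : EReal) := fun v hv =>
    (le_iSup₂ (f := fun v (_ : v ∈ Y) => Φ lam v) v hv).trans hle
  have hl : G lam < ⊤ := by
    by_contra hl
    obtain ⟨v, hv⟩ := h_proper
    have := hall v hv
    rw [hΦtop lam v hl, top_le_iff] at this
    exact EReal.coe_ne_top _ this
  refine ⟨lam, hl, fun v hv => ?_⟩
  have := hall v hv
  rw [hΦ lam v hl, EReal.coe_le_coe_iff] at this
  simp only [ψ] at this
  linarith

/-- A lower bound on the proxy from the linear path with end point `v`. -/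
theorem le_varianceProxy_of_linear (hT : 0 < T) (hG : IsProperCumulant G) (θ : M n T) {v : E n}
    {ρ : ℝ} (hρ : ∀ lam, G lam < ⊤ → inner ℝ v lam - T * (G lam).toReal ≤ ρ) :
    2 * h v - ((inner ℝ v (tailMean θ) : ℝ) : EReal) + cumulantIntegral G θ - (ρ : EReal) ≤
      varianceProxy G (europeanLogPayoff hT h) θ := by
  let x : LPath n T := fun t => (t : ℝ) • (T⁻¹ • v)
  have hx : x ∈ Vr n T := linear_mem_Vr hT _
  have hpair : ∀ μ : M n T, pairing x μ = inner ℝ v (tailMean μ) := fun μ => by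
    rw [pairing_linear, tailMean, real_inner_smul_left, real_inner_smul_right]
  have hfinal : europeanLogPayoff hT h x = h v := by
    have : ((finalTime hT : Set.Icc (0 : ℝ) T) : ℝ) = T := rfl
    simp only [europeanLogPayoff, x, this, smul_smul, mul_inv_cancel₀ hT.ne', one_smul]
  -- On a linear path the pairing depends on μ only through its tail mean, and Jensen bounds 𝒢(μ)
  -- below by T G of that mean.
  have hrate : rate G x ≤ (ρ : EReal) := by
    rw [rate, if_pos hx]
    refine iSup_le fun μ => ?_
    have hJ := mul_cumulant_tailMean_le hT hG μ
    by_cases hμ : cumulantIntegral G μ < ⊤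
    · have hlt : G (tailMean μ) < ⊤ := by
        by_contra hcon
        rw [not_lt_top_iff.1 hcon, EReal.coe_mul_top_of_pos hT, top_le_iff] at hJ
        exact hμ.ne hJ
      refine (EReal.sub_le_sub le_rfl hJ).trans ?_
      rw [coe_toReal_cumulant hG hlt, hpair, ← EReal.coe_mul, ← EReal.coe_sub,
        EReal.coe_le_coe_iff]
      exact hρ _ hlt
    · rw [not_lt_top_iff.1 hμ, EReal.sub_top]
      exact bot_le
  refine le_trans ?_ (le_iSup₂ (f := fun x (_ : x ∈ Vr n T) => 2 * europeanLogPayoff hT h x -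
    ((pairing x θ : ℝ) : EReal) + cumulantIntegral G θ - rate G x) x hx)
  rw [hfinal, hpair]
  exact EReal.sub_le_sub le_rfl hrate

/-- Every measure with finite proxy is dominated by a measure `v δ_T`, strictly unless it equals
`v δ_T` on `(0,T]`. -/
theorem exists_le_varianceProxy (hT : 0 < T) (hG : IsProperCumulant G) (h_ne_top : ∀ v, h v ≠ ⊤)
    (h_proper : ∃ v, h v ≠ ⊥) (h_concave : EConcaveOn Set.univ h) (h_usc : UpperSemicontinuous h)
    {θ : M n T} (hθ : varianceProxy G (europeanLogPayoff hT h) θ < ⊤) :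
    ∃ v, 2 * euroObjective T G h v ≤ varianceProxy G (europeanLogPayoff hT h) θ ∧
      (varianceProxy G (europeanLogPayoff hT h) θ ≤ 2 * euroObjective T G h v →
        ∀ t : Set.Icc (0 : ℝ) T, 0 < (t : ℝ) → θ (Set.Ici t) = v) := by
  set F := varianceProxy G (europeanLogPayoff hT h) θ with hF
  obtain ⟨w, hw⟩ := h_proper
  obtain ⟨C, -, hC⟩ := hG.exists_le
  obtain ⟨R, hR⟩ := hG.bounded.subset_closedBall 0
  have hw' := EReal.coe_toReal (h_ne_top w) hw
  -- A crude a priori bound: this ρ is admissible since the effective domain lies in the ball of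
  -- radius R and G ≥ −C. It shows that 𝒢(θ) and the proxy are finite.
  have hwρ := le_varianceProxy_of_linear (h := h) hT hG θ (v := w) (ρ := ‖w‖ * R + T * C)
    fun lam hl => by
      have h1 : inner ℝ w lam ≤ ‖w‖ * R := (real_inner_le_norm w lam).trans
        (mul_le_mul_of_nonneg_left (mem_closedBall_zero_iff.1 (hR hl)) (norm_nonneg _))
      have h2 := hC lam
      rw [coe_toReal_cumulant hG hl, EReal.coe_le_coe_iff] at h2
      have h3 := mul_le_mul_of_nonneg_left h2 hT.le
      linarith
  rw [← hF, ← hw', show (2 : EReal) = ((2 : ℝ) : EReal) from rfl, ← EReal.coe_mul,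
    ← EReal.coe_sub] at hwρ
  have hKlt : cumulantIntegral G θ < ⊤ := by
    by_contra hcon
    rw [not_lt_top_iff.1 hcon, EReal.coe_add_top, EReal.top_sub_coe, top_le_iff] at hwρ
    exact hθ.ne hwρ
  have hK := EReal.coe_toReal hKlt.ne (cumulantIntegral_ne_bot hG θ)
  set κ := (cumulantIntegral G θ).toReal with hκ
  have hFbot : F ≠ ⊥ := fun hbot => by
    rw [hbot, ← hK, ← EReal.coe_add, ← EReal.coe_sub, le_bot_iff] at hwρ
    exact EReal.coe_ne_bot _ hwρ
  have hFA := EReal.coe_toReal hθ.ne hFbot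
  set A := F.toReal
  obtain ⟨lam, hlam, hle⟩ := exists_dual_point hT hG h_ne_top ⟨w, hw⟩ h_concave h_usc
    (tailMean θ) (A - κ) fun v ρ hv hρ => by
      have h1 := le_varianceProxy_of_linear (h := h) hT hG θ hρ
      rw [← hF, ← hFA, ← hK, ← EReal.coe_toReal (h_ne_top v) hv,
        show (2 : EReal) = ((2 : ℝ) : EReal) from rfl, ← EReal.coe_mul, ← EReal.coe_sub,
        ← EReal.coe_add, ← EReal.coe_sub, EReal.coe_le_coe_iff] at h1
      linarith
  obtain ⟨hmid, hmid_le, hmid_eq⟩ := midpoint_tailMean hT hG θ hlam hKlt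
  set v := (1 / 2 : ℝ) • (lam + tailMean θ) with hv
  -- As v is the midpoint of λ and the tail mean, 2h(u) − ⟨u, tail mean + λ⟩ is 2(h(u) − ⟨u,v⟩).
  have hconj : conjugate h v ≤ (((A - κ - T * (G lam).toReal) / 2 : ℝ) : EReal) := by
    refine iSup_le fun u => ?_
    by_cases hu : h u = ⊥
    · rw [hu, EReal.bot_sub]; exact bot_le
    have h1 := hle u hu
    rw [← EReal.coe_toReal (h_ne_top u) hu, ← EReal.coe_sub, EReal.coe_le_coe_iff, hv,
      real_inner_smul_right, add_comm lam]
    linarith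
  have hc := EReal.coe_toReal (hconj.trans_lt (EReal.coe_lt_top _)).ne
    (conjugate_ne_bot ⟨w, hw⟩ v)
  rw [← hc, EReal.coe_le_coe_iff] at hconj
  have hf : 2 * euroObjective T G h v =
      ((2 * ((conjugate h v).toReal + T * (G v).toReal) : ℝ) : EReal) := by
    rw [euroObjective, ← hc, coe_toReal_cumulant hG hmid, EReal.toReal_coe, EReal.toReal_coe]
    norm_cast
  refine ⟨v, ?_, fun hge => ?_⟩
  · rw [hf, ← hFA, EReal.coe_le_coe_iff]
    linarith
  · rw [hf, ← hFA, EReal.coe_le_coe_iff] at hge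
    have hae := hmid_eq (by linarith)
    have hmean : tailMean θ = lam := by
      rw [tailMean, integral_congr_ae hae, integral_const, comap_volume_real_univ hT, smul_smul,
        inv_mul_cancel₀ hT.ne', one_smul]
    have hvl : v = lam := by
      rw [hv, hmean, ← two_smul ℝ lam, smul_smul]
      norm_num
    rw [hvl]
    exact tail_eq_of_ae_eq θ hae

theorem two_mul_le_varianceProxy (hT : 0 < T) (hG : IsProperCumulant G) (h_ne_top : ∀ v, h v ≠ ⊤)
    (h_proper : ∃ v, h v ≠ ⊥) (h_concave : EConcaveOn Set.univ h) (h_usc : UpperSemicontinuous h)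
    {v : E n} (hv : IsMinOn (euroObjective T G h) Set.univ v) (θ : M n T) :
    2 * euroObjective T G h v ≤ varianceProxy G (europeanLogPayoff hT h) θ := by
  by_cases hθ : varianceProxy G (europeanLogPayoff hT h) θ < ⊤
  · obtain ⟨w, hw, -⟩ :=
      exists_le_varianceProxy hT hG h_ne_top h_proper h_concave h_usc hθ
    exact (mul_le_mul_of_nonneg_left (hv (Set.mem_univ w)) zero_le_two).trans hw
  · rw [not_lt_top_iff.1 hθ]; exact le_top

/-- Tails at positive times determine the restriction, because (0,T] is the increasing union of the
intervals [T/(k+1),T]. -/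
theorem restrict_eq_dirac_iff (hT : 0 < T) (θ : M n T) (v : E n) :
    θ.restrict (Set.Ioi (initTime hT)) = VectorMeasure.dirac (finalTime hT) v ↔
      ∀ t : Set.Icc (0 : ℝ) T, 0 < (t : ℝ) → θ (Set.Ici t) = v := by
  have hsub : ∀ t : Set.Icc (0 : ℝ) T, 0 < (t : ℝ) →
      Set.Ici t ∩ Set.Ioi (initTime hT) = Set.Ici t := fun t ht =>
    Set.inter_eq_left.2 fun s hs => lt_of_lt_of_le (show initTime hT < t from ht) hs
  constructor
  · intro hr t ht
    rw [← dirac_tail hT v t, ← hr, VectorMeasure.restrict_apply _ measurableSet_Ioi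
      measurableSet_Ici, hsub t ht]
  · intro hθ
    have h1 : ∀ t : Set.Icc (0 : ℝ) T, 0 < (t : ℝ) →
        θ.restrict (Set.Ioi (initTime hT)) (Set.Ici t) = v := fun t ht => by
      rw [VectorMeasure.restrict_apply _ measurableSet_Ioi measurableSet_Ici, hsub t ht, hθ t ht]
    refine ext_of_tail hT fun t => ?_
    rw [dirac_tail]
    rcases t.2.1.lt_or_eq with ht | ht
    · exact h1 t ht
    obtain rfl : t = initTime hT := Subtype.ext ht.symm
    rw [VectorMeasure.restrict_apply _ measurableSet_Ioi measurableSet_Ici,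
      Set.inter_eq_right.2 Set.Ioi_subset_Ici_self]
    let r : ℕ → Set.Icc (0 : ℝ) T := fun k => ⟨T / ((k : ℝ) + 1), by positivity,
      div_le_self hT.le (by linarith [Nat.cast_nonneg (α := ℝ) k])⟩
    have hr0 : ∀ k, (0 : ℝ) < r k := fun k => by
      change (0 : ℝ) < T / ((k : ℝ) + 1); positivity
    have hmono : Monotone fun k => Set.Ici (r k) := fun i j hij => Set.Ici_subset_Ici.2 <| by
      change T / ((j : ℝ) + 1) ≤ T / ((i : ℝ) + 1)
      gcongr
    have hU : (⋃ k, Set.Ici (r k)) = Set.Ioi (initTime hT) := by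
      ext s
      simp only [Set.mem_iUnion, Set.mem_Ici, Set.mem_Ioi]
      refine ⟨fun ⟨k, hk⟩ => lt_of_lt_of_le (show initTime hT < r k from hr0 k) hk, fun hs => ?_⟩
      have hlim : Tendsto (fun k => ((r k : Set.Icc (0 : ℝ) T) : ℝ)) atTop (𝓝 0) := by
        have := (tendsto_one_div_add_atTop_nhds_zero_nat (𝕜 := ℝ)).const_mul T
        simpa only [r, mul_one_div, mul_zero] using this
      obtain ⟨k, hk⟩ := (hlim.eventually_lt_const (show (0 : ℝ) < s from hs)).exists
      exact ⟨k, hk.le⟩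
    have hlim := θ.tendsto_vectorMeasure_iUnion_atTop_nat hmono fun _ => measurableSet_Ici
    rw [hU] at hlim
    simp_rw [hθ _ (hr0 _)] at hlim
    exact tendsto_nhds_unique hlim tendsto_const_nhds

end Proxy

end LevyIS

end

/-! ### Reduction of the path problem to the convex problem on ℝⁿ -/

theorem mainTheorem3 {Ω : Type*} [MeasurableSpace Ω] (P : MeasureTheory.Measure Ω)
    [MeasureTheory.IsProbabilityMeasure P] (n : ℕ) (T : ℝ) (hT : 0 < T)
    (X : ℝ≥0 → Ω → LevyIS.E n) (ν : MeasureTheory.Measure (LevyIS.E n)) (γ : LevyIS.E n)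
    (hX : LevyIS.IsLevyProcess X P) (hXν : LevyIS.HasLevyTriplet X P ν γ)
    (hA1 : LevyIS.AssumptionA1 ν) (hA2 : LevyIS.AssumptionA2 (LevyIS.cumulant X P))
    (h : LevyIS.E n → EReal) (h_ne_top : ∀ v, h v ≠ ⊤) (h_proper : ∃ v, h v ≠ ⊥)
    (h_concave : LevyIS.EConcaveOn Set.univ h) (h_usc : UpperSemicontinuous h) :
    let G := LevyIS.cumulant X P
    let H := LevyIS.europeanLogPayoff hT h
    let f := LevyIS.euroObjective T G h
    -- the hypotheses of the duality theorem hold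
    LevyIS.DualityHypotheses hT G H ∧
    -- the dual formula, and its reduction to a convex problem in dimension `n`
    ((⨅ θ, LevyIS.varianceProxy G H θ) = 2 * (⨅ θ, LevyIS.dualFunctional G H θ)) ∧
    ((⨅ θ, LevyIS.dualFunctional G H θ) = (⨅ v, f v)) ∧
    LevyIS.EConvexOn Set.univ f ∧
    -- minimizers `v` of `f` exist, and for each of them `v δ_T` is optimal
    (∃ v, IsMinOn f Set.univ v) ∧
    (∀ v, IsMinOn f Set.univ v →
      LevyIS.AsymptoticallyOptimal G H (MeasureTheory.VectorMeasure.dirac (LevyIS.finalTime hT) v) ∧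
      IsMinOn (LevyIS.dualFunctional G H) Set.univ
        (MeasureTheory.VectorMeasure.dirac (LevyIS.finalTime hT) v)) ∧
    -- if the problem is feasible, then the minimizer `v` of `f` is unique, every minimizer of the dual functional is
    -- `v δ_T`, and every asymptotically optimal parameter equals `v δ_T` up to an atom at time 0
    ((∃ v, f v < ⊤) → ∃ v, (∀ w, IsMinOn f Set.univ w ↔ w = v) ∧
      (∀ θ, IsMinOn (LevyIS.dualFunctional G H) Set.univ θ ↔
        θ = MeasureTheory.VectorMeasure.dirac (LevyIS.finalTime hT) v) ∧
      (∀ θ, LevyIS.AsymptoticallyOptimal G H θ ↔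
        θ.restrict (Set.Ioi (LevyIS.initTime hT)) =
          MeasureTheory.VectorMeasure.dirac (LevyIS.finalTime hT) v)) := by
  intro G H f
  have hG : LevyIS.IsProperCumulant G :=
    LevyIS.isProperCumulant_cumulant P (hX.measurable 1) hA2
  obtain ⟨m, hm⟩ := LevyIS.exists_isMinOn_euroObjective hT hG h_ne_top h_proper
  have hlow : ∀ {v}, IsMinOn f Set.univ v → ∀ θ, 2 * f v ≤ LevyIS.varianceProxy G H θ :=
    fun hv θ => LevyIS.two_mul_le_varianceProxy hT hG h_ne_top h_proper h_concave h_usc hv θ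
  have hup : ∀ {v} {θ : LevyIS.M n T}, (∀ t : Set.Icc (0 : ℝ) T, 0 < (t : ℝ) →
      θ (Set.Ici t) = v) → LevyIS.varianceProxy G H θ ≤ 2 * f v :=
    fun hθ => LevyIS.varianceProxy_le_of_tail hT hG h_ne_top h_proper hθ
  have hup_dirac : ∀ v, LevyIS.varianceProxy G H
      (MeasureTheory.VectorMeasure.dirac (LevyIS.finalTime hT) v) ≤ 2 * f v :=
    fun v => hup fun t _ => LevyIS.dirac_tail hT v t
  have hdual := LevyIS.iInf_dualFunctional (G := G) (h := h) hT hG h_ne_top h_proper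
  have hmin : ∀ {v}, IsMinOn f Set.univ v → ⨅ w, f w = f v := fun {v} hv =>
    le_antisymm (iInf_le _ _) (le_iInf fun w => hv (Set.mem_univ w))
  have hdual_min : ∀ {v}, IsMinOn f Set.univ v → ∀ θ, f v ≤ LevyIS.dualFunctional G H θ :=
    fun hv θ => by
      rw [← hmin hv]
      exact hdual.symm.le.trans (iInf_le _ _)
  refine ⟨LevyIS.dualityHypotheses_european hT h_concave h_usc hA2, ?_, hdual,
    LevyIS.euroObjective_convex hT hG h_ne_top, ⟨m, hm⟩, fun v hv => ⟨fun θ _ => ?_,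
      fun θ _ => ?_⟩, fun hfeas => ⟨m, fun w => ⟨fun hw => ?_, ?_⟩, fun θ => ⟨fun hθ => ?_, ?_⟩,
        fun θ => ⟨fun hθ => ?_, fun hθ => ?_⟩⟩⟩
  · rw [hdual, hmin hm]
    exact le_antisymm ((iInf_le _ _).trans (hup_dirac m)) (le_iInf (hlow hm))
  · exact (hup_dirac v).trans (hlow hv θ)
  · change LevyIS.dualFunctional G H _ ≤ LevyIS.dualFunctional G H θ
    rw [LevyIS.dualFunctional_dirac hT hG]
    exact hdual_min hv θ
  · exact LevyIS.isMinOn_euroObjective_unique hT hG h_ne_top h_proper hfeas hw hm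
  · rintro rfl
    exact hm
  · obtain ⟨u, hu⟩ := hfeas
    have h1 : LevyIS.dualFunctional G H θ ≤ f m :=
      (hθ (Set.mem_univ (MeasureTheory.VectorMeasure.dirac (LevyIS.finalTime hT) m))).trans_eq
        (LevyIS.dualFunctional_dirac hT hG m)
    -- Feasibility makes the minimal dual value finite, so a minimizer is concentrated at T.
    obtain ⟨v, rfl⟩ := LevyIS.exists_eq_dirac_of_dualFunctional_lt_top hT hG h_ne_top h_proper
      (h1.trans_lt ((hm (Set.mem_univ u)).trans_lt hu))
    have h2 : f v ≤ f m := (LevyIS.dualFunctional_dirac hT hG v).symm.le.trans h1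
    rw [LevyIS.isMinOn_euroObjective_unique hT hG h_ne_top h_proper ⟨u, hu⟩
      (fun w hw => h2.trans (hm hw)) hm]
  · rintro rfl η -
    change LevyIS.dualFunctional G H _ ≤ LevyIS.dualFunctional G H η
    rw [LevyIS.dualFunctional_dirac hT hG]
    exact hdual_min hm η
  · have h1 : LevyIS.varianceProxy G H θ ≤ 2 * f m :=
      (hθ (Set.mem_univ (MeasureTheory.VectorMeasure.dirac (LevyIS.finalTime hT) m))).trans
        (hup_dirac m)
    obtain ⟨u, hu⟩ := id hfeas
    have hfm : 2 * f m < ⊤ := by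
      obtain ⟨-, -, h2⟩ := LevyIS.euroObjective_eq_coe hT hG h_proper
        ((hm (Set.mem_univ u)).trans_lt hu)
      change 2 * LevyIS.euroObjective T G h m < ⊤
      rw [h2, show (2 : EReal) = ((2 : ℝ) : EReal) from rfl, ← EReal.coe_mul]
      exact EReal.coe_lt_top _
    -- The dominating v satisfies 2f(v) ≤ F(θ) ≤ 2f(m), so v = m and the equality case applies to θ.
    obtain ⟨v, hv, hv'⟩ := LevyIS.exists_le_varianceProxy hT hG h_ne_top h_proper h_concave h_usc
      (h1.trans_lt hfm)
    have h2 : 2 * f v ≤ 2 * f m := hv.trans h1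
    have h3 : f v ≤ f m := by
      by_contra! hlt
      by_cases hfv : f v < ⊤
      · obtain ⟨-, -, e1⟩ := LevyIS.euroObjective_eq_coe hT hG h_proper hfv
        obtain ⟨-, -, e2⟩ := LevyIS.euroObjective_eq_coe hT hG h_proper (hlt.trans hfv)
        change f v = _ at e1
        change f m = _ at e2
        rw [e1, e2, EReal.coe_lt_coe_iff] at hlt
        rw [e1, e2, show (2 : EReal) = ((2 : ℝ) : EReal) from rfl, ← EReal.coe_mul,
          ← EReal.coe_mul, EReal.coe_le_coe_iff] at h2
        linarith
      · rw [not_lt_top_iff.1 hfv, show (2 : EReal) = ((2 : ℝ) : EReal) from rfl,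
          EReal.coe_mul_top_of_pos two_pos, top_le_iff] at h2
        exact hfm.ne h2
    have hvm : v = m := LevyIS.isMinOn_euroObjective_unique hT hG h_ne_top h_proper hfeas
      (fun w hw => h3.trans (hm hw)) hm
    subst hvm
    exact (LevyIS.restrict_eq_dirac_iff hT θ v).2
      (hv' (h1.trans le_rfl))
  · intro η _
    exact (hup ((LevyIS.restrict_eq_dirac_iff hT θ m).1 hθ)).trans (hlow hm η)
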